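/- Let $\log$ denote the logarithm to base $2$. Let $\theta=(\theta_1,\theta_2,\ldots)$ denote a probability distribution on the positive integers; it is called monotonic if $\theta_1\ge\theta_2\ge\cdots$ (trailing zeros, i.e. finite alphabets, are allowed). For a binary prefix code on the sequences $x^n$ of $n$ positive integers, with length function $L$, let $R_n(L,\theta)=\frac1n E_\theta L(X^n)-H_\theta(X)$ be its average per-symbol redundancy, where $X^n$ is i.i.d. with letter distribution $\theta$ and $H_\theta(X)=-\sum_i\theta_i\log\theta_i$. Fix $\varepsilon>0$. Then there is $n_0=n_0(\varepsilon)$ such that for every $n\ge n_0$ there exists a prefix code, with length function $L^*$ not depending on $\theta$, such that for every monotonic distribution $\theta$ $$ nR_n(L^*,\theta)\;\le\;(1+\varepsilon)\,\inf_{\substack{\alpha,\rho\in\mathbb R\\ \rho>\varepsilon,\ \rho\ge\alpha+\varepsilon}}\Big\{\tfrac12(\rho+2\alpha)(\rho-\alpha)(\log n)^2n^{\alpha}+5(\log e)\,n^{1-2\alpha}+\Big(1+\frac1\rho\Big)n\sum_{i>n^{\rho}}\theta_i\log i\Big\}. $$ (If $\sum_i\theta_i\log i=\infty$, then the right-hand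 side is $+\infty$ and nothing is claimed; otherwise $H_\theta(X)$ is finite.) -/

import Mathlib

open Filter
open scoped ENNReal

namespace MonotonicCoding

/-- A binary prefix code for the sequences of `n` symbols over the alphabet `{1, 2, 3, …}`:
no codeword is a prefix of the codeword of another sequence. -/
structure PrefixCode (n : ℕ) where
  encode : (Fin n → ℕ+) → List Bool
  prefix_free : ∀ x y, encode x <+: encode y → x = y

/-- The length function `L` of a code, in bits. -/
def PrefixCode.len {n : ℕ} (C : PrefixCode n) (x : Fin n → ℕ+) : ℕ := (C.encode x).length

/-- The probability of the sequence `x` under the i.i.d. source with letter probabilities `θ`. -/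
noncomputable def seqProb (θ : PMF ℕ+) {n : ℕ} (x : Fin n → ℕ+) : ℝ≥0∞ := ∏ t, θ (x t)

/-- The expected code length, in bits, of a sequence of `n` i.i.d. letters. -/
noncomputable def expectedLength (θ : PMF ℕ+) {n : ℕ} (C : PrefixCode n) : ℝ≥0∞ :=
  ∑' x : Fin n → ℕ+, seqProb θ x * (C.len x : ℝ≥0∞)

/-- The entropy of one letter, in bits (possibly infinite). -/
noncomputable def entropy (θ : PMF ℕ+) : ℝ≥0∞ :=
  ∑' i : ℕ+, ENNReal.ofReal (-((θ i).toReal * Real.logb 2 (θ i).toReal))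

/-- The average per-symbol redundancy: expected code length per symbol minus the entropy.
Its value has no meaning when the entropy is infinite. -/
noncomputable def redundancy (θ : PMF ℕ+) {n : ℕ} (C : PrefixCode n) : EReal :=
  ((expectedLength θ C / (n : ℝ≥0∞) : ℝ≥0∞) : EReal) - ((entropy θ : ℝ≥0∞) : EReal)

/-- The sum of `θ i * log₂ i` over all letters `i > m` (possibly infinite). -/
noncomputable def tailLogSum (θ : PMF ℕ+) (m : ℝ) : ℝ≥0∞ :=
  ∑' i : {i : ℕ+ // m < (i : ℝ)}, θ i.1 * ENNReal.ofReal (Real.logb 2 (i.1 : ℝ))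

/-- The three-term bound on the block redundancy, in bits; it is `⊤` exactly when the last term
is infinite. -/
noncomputable def threeTermBound (θ : PMF ℕ+) (n : ℕ) (α ρ : ℝ) : EReal :=
  ((1 / 2 * (ρ + 2 * α) * (ρ - α) * Real.logb 2 n ^ 2 * (n : ℝ) ^ α
      + 5 * Real.logb 2 (Real.exp 1) * (n : ℝ) ^ (1 - 2 * α) : ℝ) : EReal)
    + ((ENNReal.ofReal (1 + 1 / ρ) * (n : ℝ≥0∞) * tailLogSum θ ((n : ℝ) ^ ρ) : ℝ≥0∞) : EReal)

end MonotonicCoding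

/-! One code serves all `θ`, `α` and `ρ`: the Shannon–Fano–Elias code of a countable mixture of
i.i.d. models. Against any single model it loses two bits plus minus the logarithm of that model's
prior weight (`exists_mixture_code`), so it suffices to find, for given `θ`, `α`, `ρ`, a model that
is cheap to describe and close to `θ`. The models are non-increasing step functions on the letters
up to `K`, with `m` jumps by a factor `exp y`. The jump positions form a multiset, so describing
them costs `log₂ ((K + m).choose m)`, about `m * log₂ (K / m)`. Such a profile matches a monotone
`θ` up to a factor `exp y`, down to the threshold `exp (-(y * m))` (`exists_stepProfile`). After
normalisation the first-order loss cancels, leaving at most `y ^ 2` nats per letter plus `K` times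
the threshold (`sum_mul_neg_log_div_sum_le`). Take `K` about `n ^ ρ`, `y` about `2 * n ^ (-α)`, and
`m` so that the threshold is at most `n ^ (-(ρ + 2 * α))`. Describing the profile then gives the
first term of the bound, and `n * (4 + 1) * n ^ (-2 * α)` nats the second. A letter `i > K` is
escaped with probability `1 / n` and coded with `1 / (i * (i + 1))`, costing at most `log n + 2 log
i + 1`. Since `i * θ i ≤ 1`, the entropy pays for one `log i`, and `log n < (1 / ρ) log i` gives the
third term. All remaining costs are absorbed by the factor `1 + ε` uniformly in `α` and `ρ`
(`eventually_linear_le`, `eventually_neg_modelCost_le`), although both parameters are unbounded and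
`α` may be negative. -/

/-! ### Prefix codes from subprobabilities -/

/-- The `l` lowest binary digits of `c`, most significant first. -/
def binaryWord (l c : ℕ) : List Bool := List.ofFn fun i : Fin l => c.testBit (l - 1 - i)

theorem length_binaryWord (l c : ℕ) : (binaryWord l c).length = l := by simp [binaryWord]

/-- In terms of dyadic intervals: a prefix relation between words means that the interval of the
longer word lies inside that of the shorter one. -/
theorem shiftRight_eq_of_binaryWord_prefix {l l' c c' : ℕ} (hc : c < 2 ^ l) (hc' : c' < 2 ^ l')
    (h : binaryWord l c <+: binaryWord l' c') : l ≤ l' ∧ c' >>> (l' - l) = c := by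
  have hl : l ≤ l' := by simpa [length_binaryWord] using h.length_le
  refine ⟨hl, Nat.eq_of_testBit_eq fun t => ?_⟩
  rw [Nat.testBit_shiftRight]
  by_cases ht : t < l
  · have h1 := h.getElem (i := l - 1 - t) (by rw [length_binaryWord]; omega)
    simp only [binaryWord, List.getElem_ofFn] at h1
    rw [show l - 1 - (l - 1 - t) = t by omega,
      show l' - 1 - (l - 1 - t) = l' - l + t by omega] at h1
    exact h1.symm
  · rw [Nat.testBit_lt_two_pow (lt_of_lt_of_le hc (Nat.pow_le_pow_right two_pos (by omega))),
      Nat.testBit_lt_two_pow (lt_of_lt_of_le hc' (Nat.pow_le_pow_right two_pos (by omega)))]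

/-- A positive subprobability on a countable type can be laid out as disjoint intervals
`[F x, F x + Q x)` in the unit interval. -/
theorem exists_disjoint_intervals {X : Type*} [Countable X] (Q : X → ℝ) (hpos : ∀ x, 0 < Q x)
    (hs : Summable Q) (h1 : ∑' x, Q x ≤ 1) :
    ∃ F : X → ℝ, (∀ x, 0 ≤ F x) ∧ (∀ x, F x + Q x ≤ 1) ∧
      ∀ x y, x ≠ y → F x + Q x ≤ F y ∨ F y + Q y ≤ F x := by
  classical
  obtain ⟨f, hf⟩ := exists_injective_nat X
  have hnn : ∀ (p : X → Prop) [DecidablePred p], ∀ y, 0 ≤ if p y then Q y else 0 :=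
      fun p _ y => by
    by_cases h : p y
    · rw [if_pos h]; exact (hpos y).le
    · rw [if_neg h]
  have hle : ∀ (p : X → Prop) [DecidablePred p], ∀ y, (if p y then Q y else 0) ≤ Q y :=
      fun p _ y => by
    by_cases h : p y
    · rw [if_pos h]
    · rw [if_neg h]; exact (hpos y).le
  have hind : ∀ (p : X → Prop) [DecidablePred p], Summable fun y => if p y then Q y else 0 :=
    fun p _ =>
    Summable.of_nonneg_of_le (hnn p) (hle p) hs
  have hadd : ∀ x, (∑' y, if f y < f x then Q y else 0) + Q x =
      ∑' y, if f y ≤ f x then Q y else 0 := fun x => by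
    have h2 : Q x = ∑' y, if y = x then Q y else 0 := by rw [tsum_ite_eq]
    conv_lhs => rw [h2]
    rw [← (hind fun y => f y < f x).tsum_add (hind fun y => y = x)]
    refine tsum_congr fun y => ?_
    by_cases hy : y = x
    · simp [hy]
    · have : f y ≠ f x := fun h => hy (hf h)
      simp only [hy, if_false, add_zero, le_iff_lt_or_eq, this, or_false]
  have hlt : ∀ x y, f x < f y → (∑' z, if f z < f x then Q z else 0) + Q x ≤
      ∑' z, if f z < f y then Q z else 0 := fun x y hxy => by
    rw [hadd]
    refine (hind fun z => f z ≤ f x).tsum_le_tsum (fun z => ?_) (hind fun z => f z < f y)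
    by_cases ha : f z ≤ f x
    · rw [if_pos ha, if_pos (lt_of_le_of_lt ha hxy)]
    · rw [if_neg ha]; exact hnn (fun z => f z < f y) z
  refine ⟨fun x => ∑' y, if f y < f x then Q y else 0,
    fun x => tsum_nonneg (hnn fun y => f y < f x), fun x => ?_,
    fun x y hxy => ?_⟩
  · rw [hadd]
    exact ((hind fun y => f y ≤ f x).tsum_le_tsum (hle fun y => f y ≤ f x) hs).trans h1
  · exact (lt_or_gt_of_ne fun h => hxy (hf h)).imp (hlt x y) (hlt y x)

/-- Shannon–Fano–Elias: a positive subprobability `Q` on a countable type admits a prefix code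
whose lengths exceed `-log₂ Q` by at most two bits. -/
theorem exists_prefix_encoding {X : Type*} [Countable X] (Q : X → ℝ) (hpos : ∀ x, 0 < Q x)
    (hs : Summable Q) (h1 : ∑' x, Q x ≤ 1) :
    ∃ e : X → List Bool, (∀ x y, e x <+: e y → x = y) ∧
      ∀ x, ((e x).length : ℝ) ≤ 2 - Real.logb 2 (Q x) := by
  obtain ⟨F, hF0, hle1, hdis⟩ := exists_disjoint_intervals Q hpos hs h1
  -- The extra bit makes `Q x` at least two cells of width `2 ^ (-l x)`, so `[F x, F x + Q x)`
  -- contains a whole dyadic cell, the one numbered `c x`.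
  set l : X → ℕ := fun x => ⌈-Real.logb 2 (Q x)⌉₊ + 1 with hl
  have hlQ : ∀ x, 2 ≤ Q x * 2 ^ l x := fun x => by
    have h2 : (2 : ℝ) ^ (-Real.logb 2 (Q x)) ≤ 2 ^ (⌈-Real.logb 2 (Q x)⌉₊ : ℝ) :=
      Real.rpow_le_rpow_of_exponent_le one_le_two (Nat.le_ceil _)
    rw [Real.rpow_neg two_pos.le, Real.rpow_logb two_pos (by norm_num) (hpos x),
      Real.rpow_natCast] at h2
    have h3 := mul_le_mul_of_nonneg_left h2 (hpos x).le
    rw [mul_inv_cancel₀ (hpos x).ne'] at h3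
    simp only [hl, pow_succ]
    linarith
  set c : X → ℕ := fun x => ⌈F x * 2 ^ l x⌉₊ with hc
  have hc1 : ∀ x, F x * 2 ^ l x ≤ c x := fun x => Nat.le_ceil _
  have hc2 : ∀ x, (c x : ℝ) + 1 < (F x + Q x) * 2 ^ l x := fun x => by
    have := Nat.ceil_lt_add_one (mul_nonneg (hF0 x) (pow_nonneg (two_pos.le) (l x))
      : 0 ≤ F x * (2:ℝ) ^ l x)
    have := hlQ x
    simp only [hc]
    linarith
  have hcl : ∀ x, c x < 2 ^ l x := fun x => by
    have h3 := mul_le_mul_of_nonneg_right (hle1 x) (pow_nonneg (two_pos.le) (l x) : (0:ℝ) ≤ 2 ^ l x)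
    have h4 : (c x : ℝ) < 2 ^ l x := by linarith [hc2 x]
    exact_mod_cast h4
  refine ⟨fun x => binaryWord (l x) (c x), fun x y hxy => ?_, fun x => ?_⟩
  · obtain ⟨hll, hsh⟩ := shiftRight_eq_of_binaryWord_prefix (hcl x) (hcl y) hxy
    obtain ⟨d, hd⟩ := Nat.exists_eq_add_of_le hll
    rw [hd, Nat.add_sub_cancel_left, Nat.shiftRight_eq_div_pow] at hsh
    have ha : c x * 2 ^ d ≤ c y := by rw [← hsh]; exact Nat.div_mul_le_self _ _
    have hb : c y < (c x + 1) * 2 ^ d := by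
      rw [← hsh, mul_comm]; exact Nat.lt_mul_div_succ _ (by positivity)
    have ha' : (c x : ℝ) * 2 ^ d ≤ c y := by exact_mod_cast ha
    have hb' : (c y : ℝ) < (c x + 1) * 2 ^ d := by exact_mod_cast hb
    have hpow : (2 : ℝ) ^ l y = 2 ^ l x * 2 ^ d := by rw [hd, pow_add]
    have hd0 : (0 : ℝ) < 2 ^ d := by positivity
    have hy0 : (0 : ℝ) < 2 ^ l y := by positivity
    -- Nested cells would lie in two disjoint intervals.
    by_contra hne
    rcases hdis x y hne with h | h
    · have h5 := mul_le_mul_of_nonneg_right h hy0.le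
      have h6 := mul_lt_mul_of_pos_right (hc2 x) hd0
      rw [mul_assoc, ← hpow] at h6
      linarith [hc1 y]
    · have h5 := mul_le_mul_of_nonneg_right h hy0.le
      have h6 := mul_le_mul_of_nonneg_right (hc1 x) hd0.le
      rw [mul_assoc, ← hpow] at h6
      linarith [hc2 y]
  · rw [length_binaryWord]
    have hQ1 : Q x ≤ 1 := by linarith [hle1 x, hF0 x]
    have := Nat.ceil_lt_add_one (a := -Real.logb 2 (Q x))
      (by linarith [Real.logb_nonpos one_lt_two (hpos x).le hQ1])
    simp only [hl]
    push_cast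
    linarith

/-! ### Mixtures of i.i.d. models -/

theorem tsum_pi_prod {ι : Type*} {n : ℕ} (f : Fin n → ι → ℝ≥0∞) :
    ∑' x : Fin n → ι, ∏ t, f t (x t) = ∏ t, ∑' i, f t i := by
  induction n with
  | zero => simp
  | succ n ih =>
    rw [← (Fin.consEquiv fun _ : Fin (n + 1) => ι).tsum_eq, ENNReal.tsum_prod', Fin.prod_univ_succ,
      ← ih, ← ENNReal.tsum_mul_right]
    refine tsum_congr fun a => ?_
    rw [← ENNReal.tsum_mul_left]
    refine tsum_congr fun x => ?_
    simp [Fin.prod_univ_succ]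

namespace MonotonicCoding

theorem tsum_seqProb (θ : PMF ℕ+) (n : ℕ) : ∑' x : Fin n → ℕ+, seqProb θ x = 1 := by
  simp [seqProb, tsum_pi_prod, θ.tsum_coe]

theorem tsum_seqProb_mul_apply (θ : PMF ℕ+) {n : ℕ} (t : Fin n) (g : ℕ+ → ℝ≥0∞) :
    ∑' x : Fin n → ℕ+, seqProb θ x * g (x t) = ∑' i, θ i * g i := by
  classical
  have h : ∀ x : Fin n → ℕ+, seqProb θ x * g (x t) =
      ∏ s, (θ (x s) * if s = t then g (x s) else 1) := fun x => by
    rw [Finset.prod_mul_distrib, Finset.prod_ite_eq' Finset.univ t]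
    simp [seqProb]
  simp only [h]
  rw [tsum_pi_prod (fun s i => θ i * if s = t then g i else 1), Finset.prod_eq_single t]
  · simp
  · intro s _ hs
    simp [hs, θ.tsum_coe]
  · simp

/-- The mixture of i.i.d. codes: one code performs as well as each of a family of subprobabilities
`p j` on the letters, up to the cost `-log₂ (w j)` of the index and two bits. -/
theorem exists_mixture_code {J : Type*} (n : ℕ) (w : J → ℝ≥0∞) (p : J → ℕ+ → ℝ)
    (hw : ∑' j, w j ≤ 1) (hw0 : ∃ j, w j ≠ 0) (hp0 : ∀ j i, 0 < p j i)
    (hp : ∀ j, ∑' i, ENNReal.ofReal (p j i) ≤ 1) :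
    ∃ C : PrefixCode n, ∀ θ : PMF ℕ+, ∀ j, w j ≠ 0 →
      expectedLength θ C ≤ ENNReal.ofReal (2 - Real.logb 2 (w j).toReal) +
        n * ∑' i, θ i * ENNReal.ofReal (-Real.logb 2 (p j i)) := by
  have hp1 : ∀ j i, p j i ≤ 1 := fun j i =>
    ENNReal.ofReal_le_one.1 ((ENNReal.le_tsum i).trans (hp j))
  have hw1 : ∀ j, w j ≤ 1 := fun j => (ENNReal.le_tsum j).trans hw
  set q : (Fin n → ℕ+) → ℝ≥0∞ := fun x => ∑' j, w j * ∏ t, ENNReal.ofReal (p j (x t)) with hq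
  have hq1 : ∑' x, q x ≤ 1 := by
    rw [hq, ENNReal.tsum_comm]
    refine le_trans (ENNReal.tsum_le_tsum fun j => ?_) hw
    rw [ENNReal.tsum_mul_left, tsum_pi_prod fun _ i => ENNReal.ofReal (p j i)]
    exact mul_le_of_le_one_right' (Finset.prod_le_one' fun _ _ => hp j)
  have hqtop : ∀ x, q x ≠ ∞ := fun x =>
    ne_top_of_le_ne_top ENNReal.one_ne_top ((ENNReal.le_tsum x).trans hq1)
  -- The mixture dominates each weighted component, so its ideal code length exceeds that of
  -- component `j` by at most `-log₂ (w j)`.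
  have hqle : ∀ j x, w j * ENNReal.ofReal (∏ t, p j (x t)) ≤ q x := fun j x => by
    rw [ENNReal.ofReal_prod_of_nonneg fun t _ => (hp0 j _).le]
    exact ENNReal.le_tsum (f := fun j => w j * ∏ t, ENNReal.ofReal (p j (x t))) j
  have hQle : ∀ j x, (w j).toReal * ∏ t, p j (x t) ≤ (q x).toReal := fun j x => by
    have := ENNReal.toReal_mono (hqtop x) (hqle j x)
    rwa [ENNReal.toReal_mul, ENNReal.toReal_ofReal (Finset.prod_nonneg fun t _ => (hp0 j _).le)]
      at this
  have hwpos : ∀ j, w j ≠ 0 → 0 < (w j).toReal := fun j hj =>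
    ENNReal.toReal_pos hj (ne_top_of_le_ne_top ENNReal.one_ne_top (hw1 j))
  have hQpos : ∀ x, 0 < (q x).toReal := fun x => by
    obtain ⟨j, hj⟩ := hw0
    exact lt_of_lt_of_le (mul_pos (hwpos j hj) (Finset.prod_pos fun t _ => hp0 j _)) (hQle j x)
  have htop : ∑' x, q x ≠ ∞ := ne_top_of_le_ne_top ENNReal.one_ne_top hq1
  obtain ⟨e, he, hlen⟩ := exists_prefix_encoding (fun x => (q x).toReal) hQpos
    (ENNReal.summable_toReal htop)
    (by rw [← ENNReal.tsum_toReal_eq hqtop]; exact ENNReal.toReal_mono ENNReal.one_ne_top hq1)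
  refine ⟨⟨e, he⟩, fun θ j hj => ?_⟩
  have hlen' : ∀ x, (((⟨e, he⟩ : PrefixCode n).len x : ℕ) : ℝ≥0∞) ≤
      ENNReal.ofReal (2 - Real.logb 2 (w j).toReal) +
        ∑ t, ENNReal.ofReal (-Real.logb 2 (p j (x t))) := fun x => by
    have hlog : ∀ i, 0 ≤ -Real.logb 2 (p j i) := fun i =>
      neg_nonneg.2 (Real.logb_nonpos one_lt_two (hp0 j i).le (hp1 j i))
    have hlogw : 0 ≤ 2 - Real.logb 2 (w j).toReal := by
      have := Real.logb_nonpos one_lt_two (hwpos j hj).le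
        (ENNReal.toReal_mono ENNReal.one_ne_top (hw1 j))
      linarith
    rw [← ENNReal.ofReal_sum_of_nonneg fun t _ => hlog _,
      ← ENNReal.ofReal_add hlogw (Finset.sum_nonneg fun t _ => hlog _), ← ENNReal.ofReal_natCast]
    refine ENNReal.ofReal_le_ofReal ((hlen x).trans ?_)
    have h2 : Real.logb 2 ((w j).toReal * ∏ t, p j (x t)) ≤ Real.logb 2 (q x).toReal :=
      Real.logb_le_logb_of_le one_lt_two
        (mul_pos (hwpos j hj) (Finset.prod_pos fun t _ => hp0 j _)) (hQle j x)
    rw [Real.logb_mul (hwpos j hj).ne' (Finset.prod_pos fun t _ => hp0 j _).ne',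
      Real.logb_prod (s := Finset.univ) (hf := fun t _ => (hp0 j _).ne')] at h2
    rw [Finset.sum_neg_distrib]
    linarith
  calc expectedLength θ ⟨e, he⟩
      ≤ ∑' x : Fin n → ℕ+, (seqProb θ x * ENNReal.ofReal (2 - Real.logb 2 (w j).toReal) +
          ∑ t, seqProb θ x * ENNReal.ofReal (-Real.logb 2 (p j (x t)))) := by
        refine ENNReal.tsum_le_tsum fun x => ?_
        rw [← Finset.mul_sum, ← mul_add]
        gcongr
        exact hlen' x
    _ = _ := by
        rw [ENNReal.tsum_add, ENNReal.tsum_mul_right, tsum_seqProb, one_mul,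
          Summable.tsum_finsetSum fun _ _ => ENNReal.summable]
        congr 1
        rw [Finset.sum_congr rfl fun t _ => tsum_seqProb_mul_apply θ t
          fun i => ENNReal.ofReal (-Real.logb 2 (p j i))]
        simp

end MonotonicCoding

/-! ### The cost of one letter -/

/-- The distribution `1 / (i (i + 1))` on the positive integers. -/
noncomputable def harmonicWeight (i : ℕ+) : ℝ := 1 / ((i : ℝ) * ((i : ℝ) + 1))

theorem harmonicWeight_pos (i : ℕ+) : 0 < harmonicWeight i := by
  have : (0 : ℝ) < i := by exact_mod_cast i.pos
  unfold harmonicWeight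
  positivity

theorem tsum_harmonicWeight_le_one : ∑' i, ENNReal.ofReal (harmonicWeight i) ≤ 1 := by
  rw [← Equiv.pnatEquivNat.symm.tsum_eq]
  refine ENNReal.tsum_le_of_sum_range_le fun N => ?_
  have h : ∀ N : ℕ, ∑ k ∈ Finset.range N, harmonicWeight (Equiv.pnatEquivNat.symm k) =
      1 - 1 / ((N : ℝ) + 1) := fun N => by
    induction N with
    | zero => simp
    | succ N ih =>
      rw [Finset.sum_range_succ, ih]
      simp only [harmonicWeight, Equiv.pnatEquivNat_symm_apply, Nat.succPNat_coe, Nat.succ_eq_add_one]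
      push_cast
      field_simp
      ring
  rw [← ENNReal.ofReal_sum_of_nonneg fun i _ => (harmonicWeight_pos _).le, h]
  refine ENNReal.ofReal_le_one.2 ?_
  have : (0 : ℝ) ≤ 1 / ((N : ℝ) + 1) := by positivity
  linarith

theorem neg_logb_harmonicWeight_le (i : ℕ+) :
    -Real.logb 2 (harmonicWeight i) ≤ 2 * Real.logb 2 i + 1 := by
  have h1 : (1 : ℝ) ≤ i := by exact_mod_cast Nat.succ_le_of_lt i.pos
  have h0 : (0 : ℝ) < i := by linarith
  rw [harmonicWeight, one_div, Real.logb_inv, neg_neg]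
  calc Real.logb 2 ((i : ℝ) * (i + 1)) ≤ Real.logb 2 ((i : ℝ) * (i * 2)) :=
        Real.logb_le_logb_of_le one_lt_two (by positivity) (by nlinarith)
    _ = 2 * Real.logb 2 i + 1 := by
        rw [Real.logb_mul h0.ne' (by positivity), Real.logb_mul h0.ne' two_ne_zero,
          Real.logb_self_eq_one one_lt_two]
        ring

/-- Encoding with a piecewise approximation `q` of `θ`: the loss is quadratic in the logarithmic
precision `Y`, plus `τ` for every value that falls below the threshold `τ`. -/
theorem sum_mul_neg_log_div_sum_le {ι : Type*} (S : Finset ι) (θ q : ι → ℝ) (Y τ : ℝ)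
    (hτ : 0 ≤ τ) (hq : ∀ i, 0 < q i) (hθ : ∀ i, 0 ≤ θ i) (hθ1 : ∑ i ∈ S, θ i ≤ 1)
    (h : ∀ i ∈ S, (q i ≤ θ i ∧ θ i ≤ Real.exp Y * q i) ∨ (θ i ≤ q i ∧ q i = τ)) :
    ∑ i ∈ S, θ i * -Real.log (q i / ∑ k ∈ S, q k) ≤
      ∑ i ∈ S, -(θ i * Real.log (θ i)) + (Y ^ 2 + S.card * τ) := by
  rcases S.eq_empty_or_nonempty with rfl | hS
  · simpa using sq_nonneg Y
  have hZ : 0 < ∑ k ∈ S, q k := Finset.sum_pos (fun i _ => hq i) hS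
  have hterm : ∀ i ∈ S, θ i * -Real.log (q i) ≤
      -(θ i * Real.log (θ i)) + (θ i - q i + (θ i * Y ^ 2 + τ)) := fun i hi => by
    rcases h i hi with ⟨h1, h2⟩ | ⟨h1, h2⟩
    · have hpos : 0 < θ i := (hq i).trans_le h1
      set y := Real.log (θ i / q i) with hy
      have hylog : y = Real.log (θ i) - Real.log (q i) := Real.log_div hpos.ne' (hq i).ne'
      have hy0 : 0 ≤ y := Real.log_nonneg ((one_le_div (hq i)).2 h1)
      have hyY : y ≤ Y := by
        rw [hy, Real.log_le_iff_le_exp (div_pos hpos (hq i)), div_le_iff₀ (hq i)]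
        exact h2
      have hexp : q i = θ i * Real.exp (-y) := by
        rw [Real.exp_neg, hy, Real.exp_log (div_pos hpos (hq i))]
        have := (hq i).ne'
        field_simp
      -- From `exp (-y) ≤ 1 / (1 + y)` and `(1 + y) * (1 - y + y ^ 2) = 1 + y ^ 3`.
      have he : Real.exp (-y) ≤ 1 - y + y ^ 2 := by
        have h3 : 1 + y ≤ Real.exp y := by linarith [Real.add_one_le_exp y]
        rw [Real.exp_neg]
        refine (inv_anti₀ (by linarith) h3).trans ?_
        rw [inv_le_iff_one_le_mul₀ (by linarith)]
        nlinarith [pow_nonneg hy0 3]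
      have hsq : y ^ 2 ≤ Y ^ 2 := pow_le_pow_left₀ hy0 hyY 2
      have h4 : θ i * Real.exp (-y) ≤ θ i * (1 - y + Y ^ 2) :=
        mul_le_mul_of_nonneg_left (by linarith) hpos.le
      rw [← hexp, hylog] at h4
      nlinarith
    · have h3 : θ i * Real.log (θ i) ≤ θ i * Real.log (q i) := by
        rcases (hθ i).eq_or_lt with h0 | h0
        · simp [← h0]
        · exact mul_le_mul_of_nonneg_left (Real.log_le_log h0 h1) (hθ i)
      have := mul_nonneg (hθ i) (sq_nonneg Y)
      have := hθ i
      linarith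
  have hsum := Finset.sum_le_sum hterm
  simp only [Finset.sum_add_distrib, Finset.sum_sub_distrib, ← Finset.sum_mul,
    Finset.sum_const, nsmul_eq_mul] at hsum
  have hM0 : 0 ≤ ∑ i ∈ S, θ i := Finset.sum_nonneg fun i _ => hθ i
  have hsplit : ∑ i ∈ S, θ i * -Real.log (q i / ∑ k ∈ S, q k) =
      ∑ i ∈ S, θ i * -Real.log (q i) + (∑ i ∈ S, θ i) * Real.log (∑ k ∈ S, q k) := by
    rw [Finset.sum_mul, ← Finset.sum_add_distrib]
    refine Finset.sum_congr rfl fun i _ => ?_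
    rw [Real.log_div (hq i).ne' hZ.ne']
    ring
  -- The linear terms `θ i - q i` sum to mass minus normaliser, and `log Z ≤ Z - 1` cancels them.
  have hlogZ := mul_le_mul_of_nonneg_left (Real.log_le_sub_one_of_pos hZ) hM0
  have h5 := mul_le_mul_of_nonneg_right hθ1 hZ.le
  have h6 := mul_le_mul_of_nonneg_right hθ1 (sq_nonneg Y)
  rw [hsplit]
  linarith

/-- Reserving escape mass `1 / n` thus costs at most 2 nats over a block of `n` letters. -/
theorem neg_log_one_sub_inv_le {n : ℕ} (hn : 2 ≤ n) : -Real.log (1 - 1 / n) ≤ 2 / n := by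
  have h2 : (2 : ℝ) ≤ n := by exact_mod_cast hn
  have h0 : (0 : ℝ) < n := by linarith
  have hpos : (0 : ℝ) < 1 - 1 / n := by
    rw [sub_pos, div_lt_one h0]; linarith
  rw [← Real.log_inv]
  refine (Real.log_le_sub_one_of_pos (inv_pos.2 hpos)).trans ?_
  rw [sub_le_iff_le_add, inv_le_iff_one_le_mul₀ hpos]
  field_simp
  nlinarith

namespace MonotonicCoding

/-- The first `i` letters each have probability at least `θ i`. This is how the entropy is bounded
below by `log i` on rare letters. -/
theorem mul_apply_le_one (θ : PMF ℕ+) (hθ : Antitone (θ : ℕ+ → ℝ≥0∞)) (i : ℕ+) :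
    (i : ℝ) * (θ i).toReal ≤ 1 := by
  have h : (i : ℝ≥0∞) * θ i ≤ 1 := calc
    (i : ℝ≥0∞) * θ i = ∑ _k ∈ Finset.Icc 1 i, θ i := by simp
    _ ≤ ∑ k ∈ Finset.Icc 1 i, θ k := Finset.sum_le_sum fun k hk => hθ (Finset.mem_Icc.1 hk).2
    _ ≤ ∑' k, θ k := ENNReal.sum_le_tsum _
    _ = 1 := θ.tsum_coe
  simpa using ENNReal.toReal_mono ENNReal.one_ne_top h

/-- Letters up to `K` are coded with the normalisation of `q`, larger letters with an escape
probability `1 / n` followed by `harmonicWeight`. -/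
noncomputable def letterModel (n : ℕ) (K : ℕ+) (q : ℕ+ → ℝ) (i : ℕ+) : ℝ :=
  if i ≤ K then (1 - 1 / n) * (q i / ∑ k ∈ Finset.Icc 1 K, q k) else 1 / n * harmonicWeight i

theorem letterModel_pos {n : ℕ} (hn : 2 ≤ n) (K : ℕ+) {q : ℕ+ → ℝ}
    (hq : ∀ i, 0 < q i) (i : ℕ+) : 0 < letterModel n K q i := by
  have h2 : (2 : ℝ) ≤ n := by exact_mod_cast hn
  have hn1 : (0 : ℝ) < 1 - 1 / n := by
    rw [sub_pos, div_lt_one (by linarith)]; linarith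
  have hZ : 0 < ∑ k ∈ Finset.Icc 1 K, q k := Finset.sum_pos (fun i _ => hq i) ⟨1, by simp⟩
  unfold letterModel
  split_ifs
  · exact mul_pos hn1 (div_pos (hq i) hZ)
  · exact mul_pos (by positivity) (harmonicWeight_pos i)

theorem tsum_letterModel_le_one {n : ℕ} (hn : 2 ≤ n) (K : ℕ+) {q : ℕ+ → ℝ}
    (hq : ∀ i, 0 < q i) :
    ∑' i, ENNReal.ofReal (letterModel n K q i) ≤ 1 := by
  have h2 : (2 : ℝ) ≤ n := by exact_mod_cast hn
  have hn1 : (0 : ℝ) ≤ 1 - 1 / n := by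
    rw [sub_nonneg, div_le_one (by linarith)]; linarith
  have hZ : 0 < ∑ k ∈ Finset.Icc 1 K, q k := Finset.sum_pos (fun i _ => hq i) ⟨1, by simp⟩
  calc ∑' i, ENNReal.ofReal (letterModel n K q i)
      ≤ ∑' i, ((if i ∈ Finset.Icc 1 K then
          ENNReal.ofReal ((1 - 1 / n) * (q i / ∑ k ∈ Finset.Icc 1 K, q k)) else 0) +
          ENNReal.ofReal (1 / n) * ENNReal.ofReal (harmonicWeight i)) := by
        refine ENNReal.tsum_le_tsum fun i => ?_
        unfold letterModel
        by_cases hi : i ≤ K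
        · simp [hi]
        · rw [if_neg hi, ← ENNReal.ofReal_mul (by positivity)]
          exact le_add_self
    _ ≤ ENNReal.ofReal (1 - 1 / n) + ENNReal.ofReal (1 / n) := by
        rw [ENNReal.tsum_add, ENNReal.tsum_mul_left]
        refine add_le_add (le_of_eq ?_) (mul_le_of_le_one_right' tsum_harmonicWeight_le_one)
        rw [tsum_eq_sum (s := Finset.Icc 1 K) fun i hi => if_neg hi,
          Finset.sum_congr rfl fun i hi => if_pos hi,
          ← ENNReal.ofReal_sum_of_nonneg fun i _ => mul_nonneg hn1 (div_nonneg (hq i).le hZ.le),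
          ← Finset.mul_sum, ← Finset.sum_div, div_self hZ.ne', mul_one]
    _ = 1 := by
        rw [← ENNReal.ofReal_add hn1 (by positivity)]
        simp

/-- Expected cost of one letter under `letterModel`. -/
theorem tsum_mul_neg_logb_letterModel_le {n : ℕ} (hn : 2 ≤ n) (K : ℕ+) {q : ℕ+ → ℝ}
    (hq : ∀ i, 0 < q i) (θ : PMF ℕ+) (hθ : Antitone (θ : ℕ+ → ℝ≥0∞))
    (Y τ : ℝ) (hτ : 0 ≤ τ)
    (h : ∀ i ≤ K, (q i ≤ (θ i).toReal ∧ (θ i).toReal ≤ Real.exp Y * q i) ∨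
      ((θ i).toReal ≤ q i ∧ q i = τ)) :
    ∑' i, θ i * ENNReal.ofReal (-Real.logb 2 (letterModel n K q i)) ≤
      entropy θ + ENNReal.ofReal ((Y ^ 2 + K * τ + 2 / n) / Real.log 2) +
        ∑' i : ℕ+, if K < i then
          θ i * ENNReal.ofReal (Real.logb 2 n + Real.logb 2 i + 1) else 0 := by
  have h2 : (2 : ℝ) ≤ n := by exact_mod_cast hn
  have hn1 : (0 : ℝ) < 1 - 1 / n := by
    rw [sub_pos, div_lt_one (by linarith)]; linarith
  have hZ : 0 < ∑ k ∈ Finset.Icc 1 K, q k := Finset.sum_pos (fun i _ => hq i) ⟨1, by simp⟩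
  have hlog2 : 0 < Real.log 2 := Real.log_pos one_lt_two
  have hθle : ∀ i, (θ i).toReal ≤ 1 := fun i =>
    ENNReal.toReal_mono ENNReal.one_ne_top (θ.coe_le_one i)
  have hθtop : ∀ i, θ i = ENNReal.ofReal (θ i).toReal := fun i =>
    (ENNReal.ofReal_toReal (θ.apply_ne_top i)).symm
  have hent : ∀ i, 0 ≤ -((θ i).toReal * Real.logb 2 (θ i).toReal) := fun i => by
    have := Real.logb_nonpos one_lt_two ENNReal.toReal_nonneg (hθle i)
    nlinarith [(ENNReal.toReal_nonneg : 0 ≤ (θ i).toReal)]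
  have hp1 : ∀ i, 0 ≤ -Real.logb 2 (letterModel n K q i) := fun i =>
    neg_nonneg.2 (Real.logb_nonpos one_lt_two (letterModel_pos hn K hq i).le
      (ENNReal.ofReal_le_one.1 ((ENNReal.le_tsum i).trans (tsum_letterModel_le_one hn K hq))))
  have hM : ∑ i ∈ Finset.Icc 1 K, (θ i).toReal ≤ 1 := by
    rw [← ENNReal.toReal_sum fun i _ => θ.apply_ne_top i]
    refine ENNReal.toReal_mono ENNReal.one_ne_top ?_
    rw [← θ.tsum_coe]
    exact ENNReal.sum_le_tsum _
  have hhead : ∑ i ∈ Finset.Icc 1 K, θ i * ENNReal.ofReal (-Real.logb 2 (letterModel n K q i)) ≤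
      ∑ i ∈ Finset.Icc 1 K, ENNReal.ofReal (-((θ i).toReal * Real.logb 2 (θ i).toReal)) +
        ENNReal.ofReal ((Y ^ 2 + K * τ + 2 / n) / Real.log 2) := by
    have hreal : ∑ i ∈ Finset.Icc 1 K, (θ i).toReal * -Real.logb 2 (letterModel n K q i) ≤
        ∑ i ∈ Finset.Icc 1 K, -((θ i).toReal * Real.logb 2 (θ i).toReal) +
          (Y ^ 2 + K * τ + 2 / n) / Real.log 2 := by
      have h3 := sum_mul_neg_log_div_sum_le (Finset.Icc 1 K) (fun i => (θ i).toReal) q Y τ hτ hq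
        (fun _ => ENNReal.toReal_nonneg) hM fun i hi => h i (Finset.mem_Icc.1 hi).2
      have h4 : ∑ i ∈ Finset.Icc 1 K, (θ i).toReal * -Real.logb 2 (letterModel n K q i) =
          (∑ i ∈ Finset.Icc 1 K, (θ i).toReal * -Real.log (q i / ∑ k ∈ Finset.Icc 1 K, q k) +
            (∑ i ∈ Finset.Icc 1 K, (θ i).toReal) * -Real.log (1 - 1 / n)) / Real.log 2 := by
        rw [Finset.sum_mul, ← Finset.sum_add_distrib, Finset.sum_div]
        refine Finset.sum_congr rfl fun i hi => ?_
        rw [letterModel, if_pos (Finset.mem_Icc.1 hi).2, Real.logb,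
          Real.log_mul hn1.ne' (div_pos (hq i) hZ).ne']
        ring
      have h5 : ∑ i ∈ Finset.Icc 1 K, -((θ i).toReal * Real.logb 2 (θ i).toReal) =
          (∑ i ∈ Finset.Icc 1 K, -((θ i).toReal * Real.log (θ i).toReal)) / Real.log 2 := by
        rw [Finset.sum_div]
        refine Finset.sum_congr rfl fun i _ => ?_
        rw [Real.logb]
        ring
      rw [h4, h5, ← add_div]
      refine div_le_div_of_nonneg_right ?_ hlog2.le
      have hcard : ((Finset.Icc 1 K).card : ℝ) = K := by simp
      rw [hcard] at h3
      have h6 : 0 ≤ -Real.log (1 - 1 / (n : ℝ)) :=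
        neg_nonneg.2 (Real.log_nonpos hn1.le (sub_le_self _ (by positivity)))
      have h7 := mul_le_mul_of_nonneg_right hM h6
      have h8 := neg_log_one_sub_inv_le hn
      linarith
    have herr : 0 ≤ (Y ^ 2 + K * τ + 2 / n) / Real.log 2 := by positivity
    rw [← ENNReal.ofReal_sum_of_nonneg fun i _ => hent i,
      ← ENNReal.ofReal_add (Finset.sum_nonneg fun i _ => hent i) herr]
    refine le_trans (le_of_eq ?_) (ENNReal.ofReal_le_ofReal hreal)
    rw [ENNReal.ofReal_sum_of_nonneg fun i _ => mul_nonneg ENNReal.toReal_nonneg (hp1 i)]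
    refine Finset.sum_congr rfl fun i _ => ?_
    rw [ENNReal.ofReal_mul ENNReal.toReal_nonneg, ← hθtop]
  -- The code spends up to `log n + 2 log i + 1` bits; monotonicity lets the entropy term pay for
  -- one `log i`.
  have htail : ∀ i, K < i → θ i * ENNReal.ofReal (-Real.logb 2 (letterModel n K q i)) ≤
      ENNReal.ofReal (-((θ i).toReal * Real.logb 2 (θ i).toReal)) +
        θ i * ENNReal.ofReal (Real.logb 2 n + Real.logb 2 i + 1) := fun i hi => by
    have hi0 : (1 : ℝ) ≤ i := by exact_mod_cast Nat.succ_le_of_lt i.pos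
    have hln : 0 ≤ Real.logb 2 n := Real.logb_nonneg one_lt_two (by linarith)
    have hli : 0 ≤ Real.logb 2 i := Real.logb_nonneg one_lt_two hi0
    have hpos : 0 ≤ Real.logb 2 n + Real.logb 2 i + 1 := by linarith
    conv_lhs => rw [hθtop i]
    conv_rhs => rw [hθtop i]
    rw [ENNReal.toReal_ofReal ENNReal.toReal_nonneg, ← ENNReal.ofReal_mul ENNReal.toReal_nonneg,
      ← ENNReal.ofReal_mul ENNReal.toReal_nonneg,
      ← ENNReal.ofReal_add (hent i) (mul_nonneg ENNReal.toReal_nonneg hpos)]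
    refine ENNReal.ofReal_le_ofReal ?_
    rw [letterModel, if_neg (not_le.2 hi), Real.logb_mul (by positivity)
      (harmonicWeight_pos i).ne', one_div, Real.logb_inv]
    rcases (ENNReal.toReal_nonneg : 0 ≤ (θ i).toReal).eq_or_lt with h0 | h0
    · simp [← h0]
    · have h3 : Real.logb 2 (θ i).toReal ≤ -Real.logb 2 i := by
        rw [← Real.logb_inv]
        refine Real.logb_le_logb_of_le one_lt_two h0 ?_
        rw [le_inv_comm₀ h0 (by linarith), ← one_div, le_div_iff₀ h0]
        exact mul_apply_le_one θ hθ i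
      have h4 := neg_logb_harmonicWeight_le i
      nlinarith
  calc ∑' i, θ i * ENNReal.ofReal (-Real.logb 2 (letterModel n K q i))
      ≤ ∑' i, ((if i ∈ Finset.Icc 1 K then
            θ i * ENNReal.ofReal (-Real.logb 2 (letterModel n K q i)) else 0) +
          ((if i ∈ Finset.Icc 1 K then 0 else
            ENNReal.ofReal (-((θ i).toReal * Real.logb 2 (θ i).toReal))) +
          if K < i then θ i * ENNReal.ofReal (Real.logb 2 n + Real.logb 2 i + 1) else 0)) := by
        refine ENNReal.tsum_le_tsum fun i => ?_
        by_cases hi : i ≤ K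
        · simp [hi]
        · simpa [hi, not_le.1 hi] using htail i (not_le.1 hi)
    _ ≤ (∑' i, if i ∈ Finset.Icc 1 K then
            ENNReal.ofReal (-((θ i).toReal * Real.logb 2 (θ i).toReal)) else 0) +
          ENNReal.ofReal ((Y ^ 2 + K * τ + 2 / n) / Real.log 2) +
          ((∑' i, if i ∈ Finset.Icc 1 K then 0 else
            ENNReal.ofReal (-((θ i).toReal * Real.logb 2 (θ i).toReal))) +
          ∑' i : ℕ+, if K < i then
            θ i * ENNReal.ofReal (Real.logb 2 n + Real.logb 2 i + 1) else 0) := by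
        rw [ENNReal.tsum_add, ENNReal.tsum_add]
        gcongr
        rw [tsum_eq_sum (s := Finset.Icc 1 K) fun i hi => if_neg hi,
          tsum_eq_sum (s := Finset.Icc 1 K) fun i hi => if_neg hi,
          Finset.sum_congr rfl fun i hi => if_pos hi, Finset.sum_congr rfl fun i hi => if_pos hi]
        exact hhead
    _ = _ := by
        rw [add_add_add_comm, ← ENNReal.tsum_add]
        conv_rhs => rw [add_assoc]
        congr 1
        refine tsum_congr fun i => ?_
        by_cases hi : i ∈ Finset.Icc 1 K <;> simp [hi]

end MonotonicCoding

/-! ### Step profiles and the universal code -/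

/-- Combines `choose ≤ (K + m) ^ m / m!` with `m ^ m / m! ≤ exp m`. -/
theorem logb_choose_add_le {K m : ℕ} (hm : 0 < m) :
    Real.logb 2 ((K + m).choose m) ≤ m * (Real.logb 2 (1 + K / m) + 1 / Real.log 2) := by
  have hm0 : (0 : ℝ) < m := by exact_mod_cast hm
  have hlog2 : 0 < Real.log 2 := Real.log_pos one_lt_two
  have hch : (0 : ℝ) < (K + m).choose m := by
    exact_mod_cast Nat.choose_pos (Nat.le_add_left m K)
  have h1 : ((K + m).choose m : ℝ) ≤ (1 + K / m) ^ m * Real.exp m := calc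
    ((K + m).choose m : ℝ) ≤ ((K + m : ℕ) : ℝ) ^ m / m.factorial := Nat.choose_le_pow_div m (K + m)
    _ = (1 + K / m) ^ m * ((m : ℝ) ^ m / m.factorial) := by
        rw [mul_div_assoc', ← mul_pow]
        congr 2
        push_cast
        field_simp
        ring
    _ ≤ _ := by
        gcongr
        exact Real.pow_div_factorial_le_exp _ hm0.le m
  have h2 := Real.log_le_log hch h1
  rw [Real.log_mul (by positivity) (by positivity), Real.log_pow, Real.log_exp] at h2
  rw [Real.logb, Real.logb, ← add_div, mul_div_assoc']
  refine div_le_div_of_nonneg_right ?_ hlog2.le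
  linarith

namespace MonotonicCoding

/-- The non-increasing step function with jumps by factors `exp y` at the positions `s`. -/
noncomputable def stepProfile {N m : ℕ} (y : ℝ) (s : Sym (Fin N) m) (i : ℕ+) : ℝ :=
  Real.exp (y * (((s : Multiset (Fin N)).countP fun b : Fin N => (i : ℕ) ≤ b : ℕ) - (m : ℝ)))

/-- Every monotone function bounded by one is approximated, down to `exp (-(y * m))`, up to a
factor `exp y` by a step profile with `m` jumps. -/
theorem exists_stepProfile (f : ℕ+ → ℝ) (hf : Antitone f) (hf1 : ∀ i, f i ≤ 1) (K : ℕ+) (m : ℕ)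
    {y : ℝ} (hy : 0 < y) :
    ∃ s : Sym (Fin (K + 1)) m, ∀ i ≤ K,
      (stepProfile y s i ≤ f i ∧ f i ≤ Real.exp y * stepProfile y s i) ∨
        (f i ≤ stepProfile y s i ∧ stepProfile y s i = Real.exp (-(y * m))) := by
  classical
  set T : ℕ → ℝ := fun l => Real.exp (y * ((l + 1 : ℕ) - (m : ℝ))) with hT
  have hTmono : ∀ a b : ℕ, a ≤ b → T a ≤ T b := fun a b hab => by
    have : (a : ℝ) ≤ b := by exact_mod_cast hab
    simp only [hT, Real.exp_le_exp]
    push_cast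
    nlinarith
  -- The letters reaching level `T l` form an initial segment, by monotonicity; `b l` is its length,
  -- possibly `0`.
  set b : Fin m → Fin (K + 1) := fun l =>
    ⟨((Finset.Icc 1 K).filter fun i => T l ≤ f i).card, Nat.lt_succ_of_le
      ((Finset.card_filter_le _ _).trans (by simp))⟩ with hb
  have hbiff : ∀ i ≤ K, ∀ l : Fin m, (i : ℕ) ≤ (b l : ℕ) ↔ T l ≤ f i := fun i hi l => by
    constructor
    · intro h
      by_contra hlt
      have hsub : (Finset.Icc 1 K).filter (fun i => T l ≤ f i) ⊆ Finset.Ico 1 i := fun k hk => by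
        obtain ⟨hk1, hk2⟩ := Finset.mem_filter.1 hk
        refine Finset.mem_Ico.2 ⟨(Finset.mem_Icc.1 hk1).1, ?_⟩
        by_contra hik
        exact hlt (hk2.trans (hf (not_lt.1 hik)))
      have h1 := Finset.card_le_card hsub
      rw [PNat.card_Ico] at h1
      have h2 : (b l : ℕ) ≤ i - 1 := h1
      have := i.pos
      omega
    · intro h
      have hsub : Finset.Icc 1 i ⊆ (Finset.Icc 1 K).filter fun i => T l ≤ f i := fun k hk => by
        obtain ⟨hk1, hk2⟩ := Finset.mem_Icc.1 hk
        exact Finset.mem_filter.2 ⟨Finset.mem_Icc.2 ⟨hk1, hk2.trans hi⟩, h.trans (hf hk2)⟩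
      have h1 := Finset.card_le_card hsub
      rw [PNat.card_Icc] at h1
      have h2 : (i : ℕ) + 1 - 1 ≤ (b l : ℕ) := h1
      omega
  refine ⟨⟨Multiset.map b Finset.univ.val, by simp⟩, fun i hi => ?_⟩
  have hex : ∃ l, m ≤ l ∨ ¬ T l ≤ f i := ⟨m, Or.inl le_rfl⟩
  -- `c` counts the levels that `f i` reaches; the alternative `m ≤ l` stops the search at the last
  -- level.
  obtain ⟨c, hc⟩ : ∃ c, c = Nat.find hex := ⟨_, rfl⟩
  have hcm : c ≤ m := hc ▸ Nat.find_min' hex (Or.inl le_rfl)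
  have hlt : ∀ l < c, T l ≤ f i := fun l hl => by
    have := Nat.find_min hex (hc ▸ hl)
    push Not at this
    exact this.2
  have hge : c = m ∨ f i < T c := by
    have := Nat.find_spec hex
    rw [← hc, not_le] at this
    exact this.imp_left fun h => le_antisymm hcm h
  have hcount : (Multiset.map b Finset.univ.val).countP (fun b : Fin (K + 1) => (i : ℕ) ≤ b) = c := by
    rw [Multiset.countP_map, ← Finset.filter_val, Finset.card_val]
    have : (Finset.univ.filter fun l : Fin m => (i : ℕ) ≤ (b l : ℕ)) =
        Finset.univ.filter fun l : Fin m => (l : ℕ) < c := by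
      refine Finset.filter_congr fun l _ => ?_
      rw [hbiff i hi]
      refine ⟨fun h => ?_, hlt l⟩
      by_contra hcl
      have hl := l.2
      rcases hge with h1 | h1
      · omega
      · exact absurd (h1.trans_le (hTmono c l (not_lt.1 hcl))) (not_lt.2 h)
    rw [this, Fin.card_filter_val_lt, min_eq_right hcm]
  have hq : stepProfile y (⟨Multiset.map b Finset.univ.val, by simp⟩ : Sym (Fin (K + 1)) m) i =
      Real.exp (y * ((c : ℝ) - m)) := by
    unfold stepProfile
    rw [← hcount]
    rfl
  rw [hq]
  have hup : f i ≤ Real.exp y * Real.exp (y * ((c : ℝ) - m)) := by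
    rcases hge with h | h
    · rw [h, sub_self, mul_zero, Real.exp_zero, mul_one]
      exact (hf1 i).trans (Real.one_le_exp hy.le)
    · rw [← Real.exp_add]
      refine h.le.trans (le_of_eq ?_)
      simp only [hT]
      push_cast
      ring_nf
  -- Only for `c = 0` can the profile exceed `f i`, and its value is then the threshold.
  rcases Nat.eq_zero_or_pos c with h0 | h0
  · rcases le_total (f i) (Real.exp (y * ((c : ℝ) - m))) with h | h
    · refine Or.inr ⟨h, ?_⟩
      rw [h0]
      congr 1
      push_cast
      ring
    · exact Or.inl ⟨h, hup⟩
  · refine Or.inl ⟨?_, hup⟩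
    have h1 := hlt (c - 1) (by omega)
    simp only [hT] at h1
    rwa [Nat.sub_add_cancel h0] at h1

/-- Bits spent on describing the model with parameters `K`, `m` and `k`. -/
noncomputable def descriptionLength (K m : ℕ) (k : ℤ) : ℝ :=
  6 + 2 * Real.logb 2 K + 2 * Real.logb 2 (m + 1) + 2 * Real.logb 2 (|(k : ℝ)| + 1) +
    Real.logb 2 ((K + m).choose m)

/-- The prior is a product of `harmonicWeight`s on the integer parameters, times the uniform law on
jump multisets. All parameters are mixed over, so a single code meets every bound at once. -/
theorem exists_universal_code {n : ℕ} (hn : 2 ≤ n) :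
    ∃ C : PrefixCode n, ∀ θ : PMF ℕ+, Antitone (θ : ℕ+ → ℝ≥0∞) → ∀ (K : ℕ+) (m : ℕ) (k : ℤ),
      expectedLength θ C ≤ ENNReal.ofReal (descriptionLength K m k) +
        n * (entropy θ + ENNReal.ofReal ((((7 / 5 : ℝ) ^ k) ^ 2 +
            K * Real.exp (-((7 / 5 : ℝ) ^ k * m)) + 2 / n) / Real.log 2) +
          ∑' i : ℕ+, if K < i then
            θ i * ENNReal.ofReal (Real.logb 2 n + Real.logb 2 i + 1) else 0) := by
  classical
  let W : ℕ+ → ℝ≥0∞ := fun i => ENNReal.ofReal (harmonicWeight i)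
  have hW1 : ∑' i, W i ≤ 1 := tsum_harmonicWeight_le_one
  let J := (a : ℕ+ × ℕ+ × ℕ+ × ℕ+) × Sym (Fin (a.1 + 1)) a.2.1.natPred
  let u : ℕ+ × ℕ+ × ℕ+ × ℕ+ → ℝ≥0∞ := fun a => W a.1 * (W a.2.1 * (W a.2.2.1 * W a.2.2.2))
  let w : J → ℝ≥0∞ := fun j => u j.1 * (Fintype.card (Sym (Fin (j.1.1 + 1)) j.1.2.1.natPred) : ℝ≥0∞)⁻¹
  let p : J → ℕ+ → ℝ := fun j =>
    letterModel n j.1.1 (stepProfile ((7 / 5 : ℝ) ^ ((j.1.2.2.1 : ℤ) - (j.1.2.2.2 : ℤ))) j.2)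
  have hu : ∑' a, u a ≤ 1 := by
    simp only [u, ENNReal.tsum_prod', ENNReal.tsum_mul_left]
    refine (ENNReal.tsum_le_tsum fun i => ?_).trans hW1
    refine mul_le_of_le_one_right' ((ENNReal.tsum_le_tsum fun i => ?_).trans hW1)
    refine mul_le_of_le_one_right' ((ENNReal.tsum_le_tsum fun i => ?_).trans hW1)
    exact mul_le_of_le_one_right' hW1
  have hw : ∑' j, w j ≤ 1 := by
    simp only [w, J]
    rw [ENNReal.tsum_sigma']
    refine (ENNReal.tsum_le_tsum fun a => ?_).trans hu
    change ∑' _s : Sym (Fin (a.1 + 1)) a.2.1.natPred,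
      u a * (Fintype.card (Sym (Fin (a.1 + 1)) a.2.1.natPred) : ℝ≥0∞)⁻¹ ≤ u a
    rw [ENNReal.tsum_mul_left]
    refine mul_le_of_le_one_right' ?_
    rw [tsum_fintype, Finset.sum_const, nsmul_eq_mul, Finset.card_univ]
    exact ENNReal.mul_inv_le_one _
  have hW0 : ∀ i, W i ≠ 0 := fun i => (ENNReal.ofReal_pos.2 (harmonicWeight_pos i)).ne'
  have hw0 : ∀ j, w j ≠ 0 := fun j =>
    mul_ne_zero (mul_ne_zero (hW0 _) (mul_ne_zero (hW0 _) (mul_ne_zero (hW0 _) (hW0 _))))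
      (ENNReal.inv_ne_zero.2 (ENNReal.natCast_ne_top _))
  have hprofile : ∀ j : J, ∀ i,
      0 < stepProfile ((7 / 5 : ℝ) ^ ((j.1.2.2.1 : ℤ) - (j.1.2.2.2 : ℤ))) j.2 i :=
    fun j i => Real.exp_pos _
  obtain ⟨C, hC⟩ := exists_mixture_code n w p hw
    ⟨⟨(1, 1, 1, 1), Sym.replicate _ 0⟩, hw0 _⟩
    (fun j => letterModel_pos hn _ (hprofile j)) fun j => tsum_letterModel_le_one hn _ (hprofile j)
  refine ⟨C, fun θ hθ K m k => ?_⟩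
  have hy : 0 < (7 / 5 : ℝ) ^ k := by positivity
  obtain ⟨s, hs⟩ := exists_stepProfile (fun i => (θ i).toReal)
    (fun a b hab => ENNReal.toReal_mono (θ.apply_ne_top _) (hθ hab))
    (fun i => ENNReal.toReal_mono ENNReal.one_ne_top (θ.coe_le_one i)) K m hy
  -- The exponent is stored as a difference of two positive integers, one of which is `1`, so its
  -- logarithm vanishes.
  have hk : ((k.toNat.succPNat : ℕ) : ℤ) - ((-k).toNat.succPNat : ℕ) = k := by
    simp only [Nat.succPNat_coe, Nat.succ_eq_add_one]
    push_cast
    omega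
  let j : J := ⟨(K, m.succPNat, k.toNat.succPNat, (-k).toNat.succPNat), s⟩
  refine (hC θ j (hw0 j)).trans ?_
  gcongr
  · have hcard : (Fintype.card (Sym (Fin (K + 1)) m) : ℝ) = (K + m : ℕ).choose m := by
      rw [Sym.card_sym_eq_choose, Fintype.card_fin]
      congr 2
      omega
    have hcardpos : (0 : ℝ) < Fintype.card (Sym (Fin (K + 1)) m) := by
      exact_mod_cast Fintype.card_pos
    have hwj : (w j).toReal = harmonicWeight K * (harmonicWeight m.succPNat *
        (harmonicWeight k.toNat.succPNat * harmonicWeight (-k).toNat.succPNat)) *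
          (Fintype.card (Sym (Fin (K + 1)) m) : ℝ)⁻¹ := by
      simp only [w, u, j, W, ENNReal.toReal_mul, ENNReal.toReal_inv, ENNReal.toReal_natCast,
        ENNReal.toReal_ofReal (harmonicWeight_pos _).le]
      rfl
    have h1 := harmonicWeight_pos K
    have h2 := harmonicWeight_pos m.succPNat
    have h3 := harmonicWeight_pos k.toNat.succPNat
    have h4 := harmonicWeight_pos (-k).toNat.succPNat
    rw [hwj, Real.logb_mul (by positivity) (by positivity), Real.logb_mul (by positivity)
      (by positivity), Real.logb_mul (by positivity) (by positivity),
      Real.logb_mul (by positivity) (by positivity), Real.logb_inv, hcard]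
    have g1 := neg_logb_harmonicWeight_le K
    have g2 := neg_logb_harmonicWeight_le m.succPNat
    have g3 := neg_logb_harmonicWeight_le k.toNat.succPNat
    have g4 := neg_logb_harmonicWeight_le (-k).toNat.succPNat
    have hkk : Real.logb 2 (k.toNat.succPNat : ℕ) + Real.logb 2 ((-k).toNat.succPNat : ℕ) =
        Real.logb 2 (|(k : ℝ)| + 1) := by
      simp only [Nat.succPNat_coe, Nat.succ_eq_add_one]
      rcases le_total 0 k with hk0 | hk0
      · obtain ⟨a, rfl⟩ := Int.eq_ofNat_of_zero_le hk0
        simp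
      · obtain ⟨a, ha⟩ := Int.eq_ofNat_of_zero_le (neg_nonneg.2 hk0)
        obtain rfl : k = -a := by omega
        simp
    have hm1 : ((m.succPNat : ℕ) : ℝ) = m + 1 := by simp
    rw [hm1] at g2
    -- The constant 6 is two bits of Shannon–Fano–Elias rounding and one for each of the four
    -- `harmonicWeight`s.
    unfold descriptionLength
    linarith
  · have h := tsum_mul_neg_logb_letterModel_le hn K (hprofile j) θ hθ ((7 / 5 : ℝ) ^ k)
      (Real.exp (-((7 / 5 : ℝ) ^ k * m))) (Real.exp_pos _).le fun i hi => by
        have := hs i hi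
        simp only [j]
        rw [hk]
        exact this
    exact h

end MonotonicCoding

/-! ### Error estimates uniform in `α` and `ρ` -/

theorem half_le_log_two : 1 / 2 ≤ Real.log 2 := by linarith [Real.log_two_gt_d9]

theorem half_logb_two_le_log {x : ℝ} (hx : 1 ≤ x) : Real.logb 2 x / 2 ≤ Real.log x := by
  have h := Real.log_nonneg hx
  have h2 := half_le_log_two
  rw [Real.logb, div_div, div_le_iff₀ (by positivity)]
  nlinarith

theorem logb_two_add_one_le {x : ℝ} (hx : 0 ≤ x) : Real.logb 2 (x + 1) ≤ 2 * x := by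
  have h := Real.log_le_sub_one_of_pos (by linarith : 0 < x + 1)
  have h2 := half_le_log_two
  rw [Real.logb, div_le_iff₀ (by linarith)]
  nlinarith

theorem one_add_mul_logb_le_rpow {x b : ℝ} (hx : 1 ≤ x) (hb : 0 ≤ b) :
    1 + b * Real.logb 2 x / 2 ≤ x ^ b := by
  have h := Real.add_one_le_exp (Real.log x * b)
  rw [← Real.rpow_def_of_pos (by linarith)] at h
  nlinarith [mul_le_mul_of_nonneg_left (half_logb_two_le_log hx) hb]

namespace MonotonicCoding

/-- The cost of describing the quantised distribution, in the form used by `threeTermBound`. -/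
noncomputable def modelCost (n : ℕ) (α ρ : ℝ) : ℝ :=
  1 / 2 * (ρ + 2 * α) * (ρ - α) * Real.logb 2 n ^ 2 * (n : ℝ) ^ α

theorem rpow_one_sub_two_mul {x : ℝ} (hx : 0 < x) (α : ℝ) :
    x ^ (1 - 2 * α) = x * (x ^ (-α)) ^ 2 := by
  rw [← Real.rpow_natCast, ← Real.rpow_mul hx.le]
  nth_rewrite 2 [← Real.rpow_one x]
  rw [← Real.rpow_add hx]
  congr 1
  push_cast
  ring

/-- Costs linear in the parameters are negligible against the bound. -/
theorem eventually_linear_le {ε η : ℝ} (hε : 0 < ε) (hη : 0 < η) :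
    ∀ᶠ n : ℕ in atTop, ∀ α ρ : ℝ, ε < ρ → α + ε ≤ ρ →
      (1 + ρ + |α|) * Real.logb 2 n ≤ η * (max 0 (modelCost n α ρ) + (n : ℝ) ^ (1 - 2 * α)) := by
  have hlog : Tendsto (fun n : ℕ => Real.logb 2 n) atTop atTop :=
    (Real.tendsto_logb_atTop one_lt_two).comp tendsto_natCast_atTop_atTop
  have hlittle : ∀ᶠ n : ℕ in atTop, Real.logb 2 n ≤ η * n := by
    have h := (Real.isLittleO_log_id_atTop.comp_tendsto tendsto_natCast_atTop_atTop).def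
      (c := η * Real.log 2) (by have := half_le_log_two; positivity)
    filter_upwards [h, eventually_ge_atTop 1] with n hn h1
    have h1' : (1 : ℝ) ≤ n := by exact_mod_cast h1
    simp only [Function.comp, id, Real.norm_eq_abs, abs_of_nonneg (Real.log_nonneg h1'),
      abs_of_nonneg (by linarith : (0 : ℝ) ≤ n)] at hn
    rw [Real.logb, div_le_iff₀ (by linarith [half_le_log_two])]
    linarith
  filter_upwards [hlog.eventually_ge_atTop ((1 / ε + 2) * 2 / (η * ε)), hlittle,
    tendsto_natCast_atTop_atTop.eventually_ge_atTop (10 / η),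
    tendsto_natCast_atTop_atTop.eventually_ge_atTop (((1 / ε + 2) / η) ^ 2),
    eventually_ge_atTop 2] with n hL hLn hn10 hnc hn2 α ρ hρ hαρ
  have hn2' : (2 : ℝ) ≤ n := by exact_mod_cast hn2
  have hn0 : (0 : ℝ) < n := by linarith
  have hn1 : (1 : ℝ) ≤ n := by linarith
  set L := Real.logb 2 (n : ℝ) with hLdef
  have hL0 : 0 ≤ L := Real.logb_nonneg one_lt_two hn1
  have hρ0 : 0 < ρ := hε.trans hρ
  have hρε : 1 ≤ 1 / ε * ρ := by rw [one_div, inv_mul_eq_div, one_le_div hε]; exact hρ.le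
  have hX0 : (0 : ℝ) ≤ (n : ℝ) ^ (1 - 2 * α) := by positivity
  -- For `α ≥ 0`, `modelCost` is at least of order `ρ * L ^ 2` and wins by a factor `L`. For `α = -b
  -- < 0` the term `n * N ^ 2` takes over, alone if `ρ ≤ 4 * b` and jointly with `modelCost`
  -- otherwise.
  rcases le_or_gt 0 α with hα | hα
  · have h1 : 1 ≤ (n : ℝ) ^ α := Real.one_le_rpow hn1 hα
    have h2 : 1 / 2 * ρ * ε * L ^ 2 ≤ modelCost n α ρ := by
      have h3 : ρ * ε ≤ (ρ + 2 * α) * (ρ - α) :=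
        mul_le_mul (by linarith) (by linarith) hε.le (by linarith)
      have h4 := mul_le_mul h3 (mul_le_mul_of_nonneg_left h1 (sq_nonneg L)) (by positivity)
        (mul_nonneg (by linarith) (by linarith))
      unfold modelCost
      nlinarith
    rw [div_le_iff₀ (by positivity)] at hL
    have h5 : (1 + ρ + |α|) * L ≤ (1 / ε + 2) * ρ * L := by
      rw [abs_of_nonneg hα]
      exact mul_le_mul_of_nonneg_right (by linarith) hL0
    have h6 := mul_le_mul_of_nonneg_right hL (mul_nonneg hρ0.le hL0)
    have h7 := mul_le_mul_of_nonneg_left (h2.trans (le_max_right 0 _)) hη.le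
    have h8 := mul_nonneg hη.le hX0
    nlinarith
  · obtain ⟨b, rfl⟩ : ∃ b, α = -b := ⟨-α, by ring⟩
    have hb : 0 < b := by linarith
    rw [abs_neg, abs_of_pos hb, rpow_one_sub_two_mul hn0, neg_neg]
    set N := (n : ℝ) ^ b with hN
    have hNlow : 1 + b * L / 2 ≤ N := one_add_mul_logb_le_rpow hn1 hb.le
    have hbL : 0 ≤ b * L := by positivity
    have hN1 : 1 ≤ N := by linarith
    have hN0 : 0 < N := by linarith
    have hNsq : N ≤ N ^ 2 := by nlinarith
    rcases le_or_gt ρ (4 * b) with hρb | hρb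
    · have h1 : (1 + ρ + b) * L ≤ (1 + 5 * b) * L :=
        mul_le_mul_of_nonneg_right (by linarith) hL0
      rw [div_le_iff₀ hη] at hn10
      have h2 : n * (1 + b * L / 2) ≤ n * N ^ 2 :=
        mul_le_mul_of_nonneg_left (hNlow.trans hNsq) hn0.le
      have h3 := mul_le_mul_of_nonneg_left h2 hη.le
      have h4 := mul_le_mul_of_nonneg_right hn10 hbL
      have h5 := mul_nonneg hη.le (le_max_left 0 (modelCost n (-b) ρ))
      nlinarith
    · set c := (1 / ε + 2) / η with hc
      have hc0 : 0 < c := by positivity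
      set R := ρ * L with hR
      have hR0 : 0 ≤ R := by positivity
      have h1 : (1 + ρ + b) * L ≤ η * (c * R) := by
        have : η * (c * R) = (1 / ε + 2) * ρ * L := by rw [hc, hR]; field_simp
        rw [this]
        exact mul_le_mul_of_nonneg_right (by linarith) hL0
      have h2 : R ^ 2 / (4 * N) ≤ modelCost n (-b) ρ := by
        unfold modelCost
        rw [Real.rpow_neg hn0.le, ← hN, ← hLdef, ← div_eq_mul_inv, div_le_div_iff₀ (by positivity) hN0]
        have h3 : ρ * ρ ≤ 2 * ((ρ + 2 * -b) * (ρ - -b)) := by nlinarith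
        have h4 := mul_le_mul_of_nonneg_right h3 (by positivity : 0 ≤ L ^ 2 * N)
        rw [hR]
        nlinarith
      -- Completing the square trades the linear cost for the quadratic `modelCost` plus `c ^ 2 *
      -- N`, which `n * N ^ 2` dominates.
      have h5 : c * R ≤ R ^ 2 / (4 * N) + n * N ^ 2 := by
        have h6 : R ^ 2 / (4 * N) - c * R + c ^ 2 * N = (R / (2 * N) - c) ^ 2 * N := by
          field_simp
          ring
        have h7 : 0 ≤ (R / (2 * N) - c) ^ 2 * N := by positivity
        have h8 : c ^ 2 * N ≤ n * N ^ 2 := mul_le_mul hnc hNsq hN0.le hn0.le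
        linarith
      refine h1.trans (mul_le_mul_of_nonneg_left ?_ hη.le)
      linarith [le_max_right 0 (modelCost n (-b) ρ)]

/-- Where `modelCost` is negative, it is negligible against the second term of the bound. -/
theorem eventually_neg_modelCost_le {ε η : ℝ} (hε : 0 < ε) (hη : 0 < η) :
    ∀ᶠ n : ℕ in atTop, ∀ α ρ : ℝ, ε < ρ → α + ε ≤ ρ →
      -modelCost n α ρ ≤ η * (n : ℝ) ^ (1 - 2 * α) := by
  filter_upwards [tendsto_natCast_atTop_atTop.eventually_ge_atTop (12 / η),
    eventually_ge_atTop 2] with n hn12 hn2 α ρ hρ hαρ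
  have hn2' : (2 : ℝ) ≤ n := by exact_mod_cast hn2
  have hn0 : (0 : ℝ) < n := by linarith
  have hn1 : (1 : ℝ) ≤ n := by linarith
  set L := Real.logb 2 (n : ℝ) with hLdef
  have hL0 : 0 ≤ L := Real.logb_nonneg one_lt_two hn1
  rcases le_or_gt 0 (ρ + 2 * α) with h | h
  · have h1 : 0 ≤ modelCost n α ρ := by
      have : 0 ≤ ρ - α := by linarith
      unfold modelCost
      positivity
    have h2 : 0 ≤ η * (n : ℝ) ^ (1 - 2 * α) := by positivity
    linarith
  · obtain ⟨b, rfl⟩ : ∃ b, α = -b := ⟨-α, by ring⟩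
    have hb : 0 < b := by linarith
    rw [rpow_one_sub_two_mul hn0, neg_neg]
    set N := (n : ℝ) ^ b with hN
    have hNlow : 1 + b * L / 2 ≤ N := one_add_mul_logb_le_rpow hn1 hb.le
    have hbL : 0 ≤ b * L := by positivity
    -- Negativity forces `ρ < 2 * b`, so the deficit is at most `3 * (b * L) ^ 2 ≤ 12 * N ^ 2`,
    -- beaten by `n * N ^ 2`.
    have h1 : -modelCost n (-b) ρ ≤ 3 * (b * L) ^ 2 := by
      have h2 : (n : ℝ) ^ (-b) ≤ 1 := Real.rpow_le_one_of_one_le_of_nonpos hn1 (by linarith)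
      have h3 : (0 : ℝ) ≤ (n : ℝ) ^ (-b) := by positivity
      have h4 : (2 * b - ρ) * (ρ + b) ≤ 2 * b * (3 * b) :=
        mul_le_mul (by linarith) (by linarith) (by linarith) (by linarith)
      have h5 := mul_le_mul h4 h2 h3 (by positivity)
      have h6 := mul_le_mul_of_nonneg_right h5 (sq_nonneg L)
      unfold modelCost
      rw [← hLdef]
      nlinarith
    have h7 : (b * L / 2) ^ 2 ≤ N ^ 2 := pow_le_pow_left₀ (by positivity) (by linarith) 2
    rw [div_le_iff₀ hη] at hn12
    have h8 := mul_le_mul hn12 h7 (sq_nonneg _) (by positivity)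
    nlinarith

/-! ### Choice of the parameters -/

/-- A geometric grid makes the precision describable by an integer. The ratio `7 / 5` works because
it is below `1 / log 2`: rounding down from `2 * δ` then keeps the lower bound `2 * log 2 * δ`,
whose `log 2` converts nats to bits in the count of jumps. -/
theorem exists_zpow_near {δ : ℝ} (hδ : 0 < δ) :
    ∃ k : ℤ, (7 / 5 : ℝ) ^ k ≤ 2 * δ ∧ 2 * Real.log 2 * δ ≤ (7 / 5 : ℝ) ^ k ∧
      |(k : ℝ)| ≤ 4 * |Real.log δ| + 4 := by
  obtain ⟨k, h1, h2⟩ := exists_mem_Ico_zpow (by positivity : 0 < 2 * δ)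
    (by norm_num : (1 : ℝ) < 7 / 5)
  refine ⟨k, h1, ?_, ?_⟩
  · rw [zpow_add_one₀ (by norm_num)] at h2
    nlinarith [Real.log_two_lt_d9]
  · have hl : 2 / 7 ≤ Real.log (7 / 5) := by
      have := Real.one_sub_inv_le_log_of_pos (by norm_num : (0 : ℝ) < 7 / 5)
      norm_num at this ⊢
      linarith
    have g1 := Real.log_le_log (by positivity) h1
    have g2 := Real.log_lt_log (by positivity) h2
    rw [Real.log_zpow, Real.log_mul two_ne_zero hδ.ne'] at g1 g2
    push_cast at g2
    have hlog2 := Real.log_two_lt_d9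
    have hlog2' := Real.log_two_gt_d9
    have ha := abs_le.1 (le_refl |Real.log δ|)
    have h0 := abs_nonneg (Real.log δ)
    rw [abs_le]
    constructor
    · by_contra hk
      push Not at hk
      have : ((k : ℝ) + 1) * Real.log (7 / 5) ≤ ((k : ℝ) + 1) * (2 / 7) :=
        mul_le_mul_of_nonpos_left hl (by linarith)
      linarith
    · by_contra hk
      push Not at hk
      have : (k : ℝ) * (2 / 7) ≤ (k : ℝ) * Real.log (7 / 5) :=
        mul_le_mul_of_nonneg_left hl (by linarith)
      linarith

/-- Parameters of the universal code for given `α` and `ρ`, with the resulting costs. -/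
theorem exists_parameters {ε : ℝ} (hε : 0 < ε) {n : ℕ} (hn : 2 ≤ n)
    (hL : 4 / ε ≤ Real.logb 2 n) {α ρ : ℝ} (hρ : ε < ρ) (hαρ : α + ε ≤ ρ) :
    ∃ (K : ℕ+) (m : ℕ) (k : ℤ), (∀ i : ℕ+, K < i ↔ (n : ℝ) ^ ρ < i) ∧
      descriptionLength K m k ≤ max 0 (modelCost n α ρ) * (1 + 7 / (ε * Real.logb 2 n)) +
        32 * (1 + ρ + |α|) * Real.logb 2 n ∧
      (n : ℝ) * ((((7 / 5 : ℝ) ^ k) ^ 2 + K * Real.exp (-((7 / 5 : ℝ) ^ k * m)) + 2 / n) /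
        Real.log 2) ≤ 5 * Real.logb 2 (Real.exp 1) * (n : ℝ) ^ (1 - 2 * α) + 4 := by
  have hn2' : (2 : ℝ) ≤ n := by exact_mod_cast hn
  have hn0 : (0 : ℝ) < n := by linarith
  have hn1 : (1 : ℝ) ≤ n := by linarith
  have hρ0 : 0 < ρ := hε.trans hρ
  have hhalf := half_le_log_two
  have hlog2 : 0 < Real.log 2 := by linarith
  have hL1 : 1 ≤ Real.logb 2 (n : ℝ) := by
    rw [Real.le_logb_iff_rpow_le one_lt_two hn0, Real.rpow_one]; exact hn2'
  have hlog : Real.log n = Real.logb 2 n * Real.log 2 := by rw [Real.logb]; field_simp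
  have hlogL := half_logb_two_le_log hn1
  set L := Real.logb 2 (n : ℝ) with hLdef
  have hL0 : 0 < L := by linarith
  have hδ : 0 < (n : ℝ) ^ (-α) := by positivity
  have hδα : (n : ℝ) ^ (-α) * (n : ℝ) ^ α = 1 := by rw [← Real.rpow_add hn0]; simp
  obtain ⟨k, hk1, hk2, hk3⟩ := exists_zpow_near hδ
  set y := (7 / 5 : ℝ) ^ k with hy
  have hy0 : 0 < y := by positivity
  have hnρ : 1 ≤ (n : ℝ) ^ ρ := Real.one_le_rpow hn1 hρ0.le
  have hfloor : 0 < ⌊(n : ℝ) ^ ρ⌋₊ := Nat.floor_pos.2 hnρ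
  -- Chosen so that `exp (-(y * m)) ≤ n ^ (-(ρ + 2 * α))`. If `ρ + 2 * α < 0` the ceiling gives `m =
  -- 0`, a constant profile.
  set m := ⌈(ρ + 2 * α) * Real.log n / y⌉₊ with hm
  have hxm : (ρ + 2 * α) * Real.log n / y ≤ m := Nat.le_ceil _
  obtain ⟨K, hKfloor⟩ : ∃ K : ℕ+, (K : ℕ) = ⌊(n : ℝ) ^ ρ⌋₊ := ⟨⟨_, hfloor⟩, rfl⟩
  have hKle : ((K : ℕ) : ℝ) ≤ (n : ℝ) ^ ρ := by
    rw [hKfloor]; exact Nat.floor_le (by positivity)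
  have hKlt : ∀ i : ℕ+, K < i ↔ (n : ℝ) ^ ρ < i := fun i => by
    rw [← Nat.floor_lt (by positivity), ← PNat.coe_lt_coe, hKfloor]
  have hK0 : (0 : ℝ) < (K : ℕ) := by exact_mod_cast K.pos
  refine ⟨K, m, k, hKlt, ?_, ?_⟩
  · set h := 1 / 2 * max 0 (ρ + 2 * α) * L * (n : ℝ) ^ α with hh
    have hh0 : 0 ≤ h := by positivity
    have hmh : (m : ℝ) ≤ h + 1 := by
      have h1 : (ρ + 2 * α) * Real.log n / y ≤ h := by
        rw [div_le_iff₀ hy0, hh]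
        have h2 : (ρ + 2 * α) * Real.log n ≤ max 0 (ρ + 2 * α) * (L * Real.log 2) := by
          rw [← hlog]
          exact mul_le_mul_of_nonneg_right (le_max_right _ _) (Real.log_nonneg hn1)
        have h3 := mul_le_mul_of_nonneg_left hk2 hh0
        have h4 : h * (2 * Real.log 2 * (n : ℝ) ^ (-α)) =
            max 0 (ρ + 2 * α) * (L * Real.log 2) * ((n : ℝ) ^ (-α) * (n : ℝ) ^ α) := by
          rw [hh]; ring
        rw [h4, hδα, mul_one] at h3
        exact h2.trans h3
      exact (Nat.ceil_le_ceil h1 |> fun h => Nat.cast_le.2 h).trans (Nat.ceil_lt_add_one hh0).le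
    have hmodel : h * ((ρ - α) * L) = max 0 (modelCost n α ρ) := by
      have hc : 0 ≤ 1 / 2 * (ρ - α) * L ^ 2 * (n : ℝ) ^ α := by
        have : 0 ≤ ρ - α := by linarith
        positivity
      have h1 : max 0 (modelCost n α ρ) =
          max 0 (ρ + 2 * α) * (1 / 2 * (ρ - α) * L ^ 2 * (n : ℝ) ^ α) := by
        rw [max_mul_of_nonneg _ _ hc, zero_mul, modelCost]
        congr 1
        ring
      rw [h1, hh]
      ring
    have h7h : h ≤ max 0 (modelCost n α ρ) / (ε * L) := by
      rw [le_div_iff₀ (by positivity), ← hmodel]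
      gcongr
      linarith
    have hchoose : Real.logb 2 ((K + m : ℕ).choose m) ≤ m * ((ρ - α) * L + 3) := by
      rcases Nat.eq_zero_or_pos m with hm0 | hm0
      · simp [hm0]
      have hm1 : (1 : ℝ) ≤ m := by exact_mod_cast hm0
      refine (logb_choose_add_le hm0).trans (mul_le_mul_of_nonneg_left ?_ (by linarith))
      -- Dividing `K` by `m` is what yields the factor `ρ - α` in place of `ρ`.
      have hαm : (n : ℝ) ^ α ≤ m := by
        rcases le_or_gt 0 α with hα | hα
        · refine le_trans ?_ hxm
          rw [le_div_iff₀ hy0]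
          have h1 := mul_le_mul_of_nonneg_left hk1 (by positivity : 0 ≤ (n : ℝ) ^ α)
          have h2 : (n : ℝ) ^ α * (2 * (n : ℝ) ^ (-α)) = 2 := by linear_combination 2 * hδα
          rw [div_le_iff₀ hε] at hL
          have h3 : ε * Real.log n ≤ (ρ + 2 * α) * Real.log n :=
            mul_le_mul_of_nonneg_right (by linarith) (Real.log_nonneg hn1)
          nlinarith
        · exact (Real.rpow_le_one_of_one_le_of_nonpos hn1 hα.le).trans hm1
      have h1 : 1 + (K : ℕ) / (m : ℝ) ≤ 2 * (n : ℝ) ^ (ρ - α) := by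
        have h2 : (K : ℕ) / (m : ℝ) ≤ (n : ℝ) ^ (ρ - α) := by
          rw [Real.rpow_sub hn0]
          exact div_le_div₀ (by positivity) hKle (by positivity) hαm
        have h3 : 1 ≤ (n : ℝ) ^ (ρ - α) := Real.one_le_rpow hn1 (by linarith)
        linarith
      have h4 := Real.logb_le_logb_of_le one_lt_two (by positivity) h1
      rw [Real.logb_mul two_ne_zero (by positivity), Real.logb_self_eq_one one_lt_two,
        Real.logb_rpow_eq_mul_logb_of_pos hn0] at h4
      have h5 : 1 / Real.log 2 ≤ 2 := by
        rw [div_le_iff₀ hlog2]; linarith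
      linarith
    have hKL : Real.logb 2 (K : ℕ) ≤ ρ * L := by
      have := Real.logb_le_logb_of_le one_lt_two hK0 hKle
      rwa [Real.logb_rpow_eq_mul_logb_of_pos hn0] at this
    have hlogm := logb_two_add_one_le (Nat.cast_nonneg (α := ℝ) m)
    have hlogk := logb_two_add_one_le (abs_nonneg (k : ℝ))
    have hkL : |(k : ℝ)| ≤ 4 * (|α| * L) + 4 := by
      rw [Real.log_rpow hn0, abs_mul, abs_neg, abs_of_nonneg (Real.log_nonneg hn1), hlog] at hk3
      have h1 : Real.log 2 ≤ 1 := by linarith [Real.log_two_lt_d9]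
      have h2 := mul_le_mul_of_nonneg_left h1 (by positivity : 0 ≤ |α| * L)
      linarith
    -- Per jump, 3 comes from `hchoose` and 4 from `2 * log₂ (m + 1) ≤ 4 * m`.
    have hfac : 0 ≤ (ρ - α) * L + 7 := by
      have : 0 ≤ ρ - α := by linarith
      positivity
    have h8 := mul_le_mul_of_nonneg_right hmh hfac
    have h9 : max 0 (modelCost n α ρ) * (1 + 7 / (ε * L)) =
        max 0 (modelCost n α ρ) + 7 * (max 0 (modelCost n α ρ) / (ε * L)) := by ring
    have h10 : -α * L ≤ |α| * L := mul_le_mul_of_nonneg_right (neg_le_abs α) hL0.le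
    have h11 : 0 ≤ |α| * L := by positivity
    have h12 : 0 ≤ ρ * L := by positivity
    rw [h9]
    unfold descriptionLength
    nlinarith
  · have hexp : (K : ℕ) * Real.exp (-(y * m)) ≤ ((n : ℝ) ^ (-α)) ^ 2 := by
      rw [div_le_iff₀ hy0] at hxm
      have h1 : Real.exp (-(y * m)) ≤ (n : ℝ) ^ (-(ρ + 2 * α)) := by
        rw [Real.rpow_def_of_pos hn0, Real.exp_le_exp]
        linarith
      calc (K : ℕ) * Real.exp (-(y * m)) ≤ (n : ℝ) ^ ρ * (n : ℝ) ^ (-(ρ + 2 * α)) :=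
            mul_le_mul hKle h1 (Real.exp_pos _).le (by positivity)
        _ = _ := by
            rw [← Real.rpow_add hn0, ← Real.rpow_natCast, ← Real.rpow_mul hn0.le]
            congr 1
            push_cast
            ring
    have hysq : y ^ 2 ≤ (2 * (n : ℝ) ^ (-α)) ^ 2 := pow_le_pow_left₀ hy0.le hk1 2
    rw [rpow_one_sub_two_mul hn0, Real.logb, Real.log_exp]
    -- The 5 is 4 from `y ≤ 2 * n ^ (-α)` and 1 from the letters below the threshold.
    have h1 : y ^ 2 + (K : ℕ) * Real.exp (-(y * m)) + 2 / n ≤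
        5 * ((n : ℝ) ^ (-α)) ^ 2 + 2 / n := by linarith
    calc _ ≤ (n : ℝ) * ((5 * ((n : ℝ) ^ (-α)) ^ 2 + 2 / n) / Real.log 2) :=
          mul_le_mul_of_nonneg_left (div_le_div_of_nonneg_right h1 hlog2.le) hn0.le
      _ = 5 * (1 / Real.log 2) * (n * ((n : ℝ) ^ (-α)) ^ 2) + 2 / Real.log 2 := by
          field_simp
      _ ≤ _ := by
          have : 2 / Real.log 2 ≤ 4 := by
            rw [div_le_iff₀ hlog2]; linarith
          linarith

theorem eventually_exists_parameters {ε : ℝ} (hε : 0 < ε) :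
    ∀ᶠ n : ℕ in atTop, ∀ α ρ : ℝ, ε < ρ → α + ε ≤ ρ →
      ∃ (K : ℕ+) (m : ℕ) (k : ℤ), (∀ i : ℕ+, K < i ↔ (n : ℝ) ^ ρ < i) ∧
        descriptionLength K m k +
          (n : ℝ) * ((((7 / 5 : ℝ) ^ k) ^ 2 + K * Real.exp (-((7 / 5 : ℝ) ^ k * m)) + 2 / n) /
            Real.log 2) ≤
        (1 + ε) * (modelCost n α ρ +
          5 * Real.logb 2 (Real.exp 1) * (n : ℝ) ^ (1 - 2 * α)) := by
  have hlog : Tendsto (fun n : ℕ => Real.logb 2 n) atTop atTop :=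
    (Real.tendsto_logb_atTop one_lt_two).comp tendsto_natCast_atTop_atTop
  obtain ⟨η, hη0, hη⟩ : ∃ η : ℝ, 0 < η ∧ (3 + ε) * η ≤ ε :=
    ⟨ε / (3 + ε), by positivity, le_of_eq (by field_simp)⟩
  -- 36 is the 32 of `exists_parameters` plus 4 for its additive constant.
  filter_upwards [eventually_linear_le hε (by positivity : 0 < η / 36),
    eventually_neg_modelCost_le hε hη0, hlog.eventually_ge_atTop (4 / ε),
    hlog.eventually_ge_atTop (7 / (ε * η)), hlog.eventually_ge_atTop 1,
    eventually_ge_atTop 2] with n hlin hneg hL hL7 hL1 hn α ρ hρ hαρ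
  obtain ⟨K, m, k, hK, hdesc, herr⟩ := exists_parameters hε hn hL hρ hαρ
  refine ⟨K, m, k, hK, ?_⟩
  have hlin := hlin α ρ hρ hαρ
  have hneg := hneg α ρ hρ hαρ
  set X := (n : ℝ) ^ (1 - 2 * α)
  set G := modelCost n α ρ
  set L := Real.logb 2 (n : ℝ)
  have hX : 0 ≤ X := by positivity
  have h7 : 7 / (ε * L) ≤ η := by
    rw [div_le_iff₀ (by positivity)] at hL7 ⊢
    linarith
  have h1 := mul_le_mul_of_nonneg_left h7 (le_max_left 0 G)
  have h2 : 4 ≤ 4 * ((1 + ρ + |α|) * L) := by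
    have : 1 ≤ (1 + ρ + |α|) * L := by
      have := abs_nonneg α
      nlinarith
    linarith
  have he : 1 ≤ Real.logb 2 (Real.exp 1) := by
    rw [Real.logb, Real.log_exp, le_div_iff₀ (by linarith [half_le_log_two])]
    linarith [Real.log_two_lt_d9]
  have hS : X ≤ 5 * Real.logb 2 (Real.exp 1) * X := by nlinarith
  set S := 5 * Real.logb 2 (Real.exp 1) * X
  have hmain : descriptionLength K m k + (n : ℝ) * ((((7 / 5 : ℝ) ^ k) ^ 2 +
      K * Real.exp (-((7 / 5 : ℝ) ^ k * m)) + 2 / n) / Real.log 2) ≤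
      max 0 G * (1 + 2 * η) + η * X + S := by linarith
  refine hmain.trans ?_
  have hηX : (3 + ε) * η * X ≤ ε * S := mul_le_mul hη hS hX hε.le
  rcases le_total 0 G with hG | hG
  · rw [max_eq_right hG]
    have hεη : 2 * η ≤ ε := by nlinarith
    have := mul_le_mul_of_nonneg_left hεη hG
    nlinarith [mul_nonneg hη0.le hX, mul_nonneg hε.le (mul_nonneg hη0.le hX)]
  · rw [max_eq_left hG]
    have := mul_le_mul_of_nonneg_left hneg (by linarith : 0 ≤ 1 + ε)
    nlinarith [mul_nonneg hη0.le hX, mul_nonneg hε.le (mul_nonneg hη0.le hX)]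

/-! ### The tail and the conclusion -/

theorem descriptionLength_nonneg (K : ℕ+) (m : ℕ) (k : ℤ) : 0 ≤ descriptionLength K m k := by
  have h1 : 0 ≤ Real.logb 2 ((K : ℕ) : ℝ) :=
    Real.logb_nonneg one_lt_two (by exact_mod_cast Nat.succ_le_of_lt K.pos)
  have h2 : 0 ≤ Real.logb 2 ((m : ℝ) + 1) :=
    Real.logb_nonneg one_lt_two (by linarith [Nat.cast_nonneg (α := ℝ) m])
  have h3 : 0 ≤ Real.logb 2 (|(k : ℝ)| + 1) :=
    Real.logb_nonneg one_lt_two (by linarith [abs_nonneg (k : ℝ)])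
  have h4 : 0 ≤ Real.logb 2 ((K + m : ℕ).choose m : ℝ) :=
    Real.logb_nonneg one_lt_two
      (by exact_mod_cast Nat.succ_le_of_lt (Nat.choose_pos (Nat.le_add_left m K)))
  unfold descriptionLength
  linarith

/-- The cost of the letters beyond `n ^ ρ`. -/
theorem tsum_tail_le (θ : PMF ℕ+) {n : ℕ} (hn : 2 ≤ n) {ε ρ : ℝ} (hε : 0 < ε) (hρ : ε < ρ)
    (hL : 1 ≤ ε * ε * Real.logb 2 n) (K : ℕ+) (hK : ∀ i : ℕ+, K < i ↔ (n : ℝ) ^ ρ < i) :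
    (∑' i : ℕ+, if K < i then θ i * ENNReal.ofReal (Real.logb 2 n + Real.logb 2 i + 1) else 0) ≤
      ENNReal.ofReal ((1 + ε) * (1 + 1 / ρ)) * tailLogSum θ ((n : ℝ) ^ ρ) := by
  have hn0 : (0 : ℝ) < n := by exact_mod_cast (by omega : 0 < n)
  have hρ0 : 0 < ρ := hε.trans hρ
  have htail : tailLogSum θ ((n : ℝ) ^ ρ) =
      ∑' i : ℕ+, if K < i then θ i * ENNReal.ofReal (Real.logb 2 i) else 0 := by
    unfold tailLogSum
    refine (tsum_subtype {i : ℕ+ | (n : ℝ) ^ ρ < i}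
      fun i => θ i * ENNReal.ofReal (Real.logb 2 i)).trans ?_
    refine tsum_congr fun i => ?_
    by_cases hi : K < i
    · rw [if_pos hi, Set.indicator_of_mem]
      exact (hK i).1 hi
    · rw [if_neg hi, Set.indicator_of_notMem]
      exact fun h => hi ((hK i).2 h)
  rw [htail, ← ENNReal.tsum_mul_left]
  refine ENNReal.tsum_le_tsum fun i => ?_
  by_cases hi : K < i
  · rw [if_pos hi, if_pos hi, mul_left_comm, ← ENNReal.ofReal_mul (by positivity)]
    gcongr
    have h1 : ρ * Real.logb 2 n ≤ Real.logb 2 i := by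
      rw [← Real.logb_rpow_eq_mul_logb_of_pos hn0]
      exact Real.logb_le_logb_of_le one_lt_two (by positivity) ((hK i).1 hi).le
    have h0 : 0 ≤ Real.logb 2 (n : ℝ) :=
      Real.logb_nonneg one_lt_two (by exact_mod_cast (by omega : 1 ≤ n))
    have h2 : Real.logb 2 n ≤ 1 / ρ * Real.logb 2 i := by
      rw [one_div, inv_mul_eq_div, le_div_iff₀ hρ0]
      linarith
    have h3 : ε * Real.logb 2 n ≤ ρ * Real.logb 2 n := mul_le_mul_of_nonneg_right hρ.le h0
    -- The spare bit is absorbed since `log i ≥ ρ * log n ≥ ε * log n`.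
    have h4 : 1 ≤ ε * Real.logb 2 i := by
      have := mul_le_mul_of_nonneg_left (h3.trans h1) hε.le
      linarith
    have h5 := mul_nonneg hε.le (h0.trans h2)
    linarith
  · simp [hi]

theorem mul_redundancy_le_of_expectedLength_le {n : ℕ} (hn : 0 < n) (θ : PMF ℕ+) (C : PrefixCode n)
    {D E c B : ℝ} {T : ℝ≥0∞} (hD : 0 ≤ D) (hE : 0 ≤ E) (hc : 0 ≤ c) (hH : entropy θ ≠ ∞)
    (hT : T ≠ ∞) (hB : D + n * E ≤ B)
    (h : expectedLength θ C ≤ ENNReal.ofReal D +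
      n * (entropy θ + ENNReal.ofReal E + ENNReal.ofReal c * T)) :
    (n : EReal) * redundancy θ C ≤ ((B + n * (c * T.toReal) : ℝ) : EReal) := by
  have hn0 : (0 : ℝ) < n := by exact_mod_cast hn
  have hcT : ENNReal.ofReal c * T ≠ ∞ := ENNReal.mul_ne_top ENNReal.ofReal_ne_top hT
  have hsum : entropy θ + ENNReal.ofReal E + ENNReal.ofReal c * T ≠ ∞ :=
    ENNReal.add_ne_top.2 ⟨ENNReal.add_ne_top.2 ⟨hH, ENNReal.ofReal_ne_top⟩, hcT⟩
  have htop : ENNReal.ofReal D + n * (entropy θ + ENNReal.ofReal E + ENNReal.ofReal c * T) ≠ ∞ :=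
    ENNReal.add_ne_top.2
      ⟨ENNReal.ofReal_ne_top, ENNReal.mul_ne_top (ENNReal.natCast_ne_top n) hsum⟩
  have hl : expectedLength θ C ≠ ∞ := ne_top_of_le_ne_top htop h
  have hdiv : expectedLength θ C / (n : ℝ≥0∞) ≠ ∞ :=
    ENNReal.div_ne_top hl (by exact_mod_cast hn.ne')
  have hreal := ENNReal.toReal_mono htop h
  rw [ENNReal.toReal_add ENNReal.ofReal_ne_top
      (ENNReal.mul_ne_top (ENNReal.natCast_ne_top n) hsum), ENNReal.toReal_mul,
    ENNReal.toReal_add (ENNReal.add_ne_top.2 ⟨hH, ENNReal.ofReal_ne_top⟩) hcT,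
    ENNReal.toReal_add hH ENNReal.ofReal_ne_top, ENNReal.toReal_mul, ENNReal.toReal_ofReal hD,
    ENNReal.toReal_ofReal hE, ENNReal.toReal_ofReal hc, ENNReal.toReal_natCast] at hreal
  rw [redundancy, ← EReal.coe_ennreal_toReal hdiv, ← EReal.coe_ennreal_toReal hH,
    ← EReal.coe_sub, ← EReal.coe_coe_eq_natCast, ← EReal.coe_mul, EReal.coe_le_coe_iff,
    ENNReal.toReal_div, ENNReal.toReal_natCast, mul_sub, mul_div_cancel₀ _ hn0.ne']
  linarith

end MonotonicCoding

theorem theorem6 (ε : ℝ) (hε : 0 < ε) :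
    ∀ᶠ n : ℕ in atTop, ∃ C : MonotonicCoding.PrefixCode n,
      ∀ θ : PMF ℕ+, Antitone (θ : ℕ+ → ℝ≥0∞) →
        (n : EReal) * MonotonicCoding.redundancy θ C ≤
          ((1 + ε : ℝ) : EReal) *
            ⨅ (α : ℝ) (ρ : ℝ) (_ : ε < ρ) (_ : α + ε ≤ ρ),
              MonotonicCoding.threeTermBound θ n α ρ := by
  have hlog : Tendsto (fun n : ℕ => Real.logb 2 n) atTop atTop :=
    (Real.tendsto_logb_atTop one_lt_two).comp tendsto_natCast_atTop_atTop
  filter_upwards [MonotonicCoding.eventually_exists_parameters hε,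
    hlog.eventually_ge_atTop (1 / (ε * ε)), eventually_ge_atTop 2] with n hparam hL hn
  rw [div_le_iff₀ (by positivity)] at hL
  have hn0 : (0 : ℝ) < n := by exact_mod_cast (by omega : 0 < n)
  obtain ⟨C, hC⟩ := MonotonicCoding.exists_universal_code hn
  refine ⟨C, fun θ hθ => ?_⟩
  -- With infinite entropy the redundancy is `⊥`, because `x - ⊤ = ⊥` in `EReal` for every `x`.
  by_cases hH : MonotonicCoding.entropy θ = ∞
  · rw [MonotonicCoding.redundancy, hH, EReal.coe_ennreal_top, EReal.sub_top,
      ← EReal.coe_coe_eq_natCast, EReal.coe_mul_bot_of_pos hn0]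
    exact bot_le
  have hε1 : (0 : ℝ) < 1 + ε := by linarith
  -- Moving `1 + ε` to the left exposes the infimum, so each pair `α`, `ρ` can be treated separately
  -- with the same `C`.
  rw [← EReal.div_le_iff_le_mul (by exact_mod_cast hε1) (EReal.coe_ne_top _)]
  refine le_iInf fun α => le_iInf fun ρ => le_iInf fun hρ => le_iInf fun hαρ => ?_
  rw [EReal.div_le_iff_le_mul (by exact_mod_cast hε1) (EReal.coe_ne_top _)]
  have hρ0 : 0 < ρ := hε.trans hρ
  have hc0 : 0 < 1 + 1 / ρ := by positivity
  obtain ⟨K, m, k, hK, hcost⟩ := hparam α ρ hρ hαρ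
  set T := MonotonicCoding.tailLogSum θ ((n : ℝ) ^ ρ) with hTdef
  by_cases hT : T = ∞
  · rw [MonotonicCoding.threeTermBound, ← hTdef, hT, ENNReal.mul_top, EReal.coe_ennreal_top,
      EReal.coe_add_top, EReal.coe_mul_top_of_pos hε1]
    · exact le_top
    · exact mul_ne_zero (ENNReal.ofReal_pos.2 hc0).ne' (by exact_mod_cast (by omega : n ≠ 0))
  have hlen := hC θ hθ K m k
  have htail := MonotonicCoding.tsum_tail_le θ hn hε hρ (by linarith) K hK
  have hE : 0 ≤ (((7 / 5 : ℝ) ^ k) ^ 2 + K * Real.exp (-((7 / 5 : ℝ) ^ k * m)) + 2 / n) /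
      Real.log 2 := div_nonneg (by positivity) (Real.log_pos one_lt_two).le
  refine (MonotonicCoding.mul_redundancy_le_of_expectedLength_le (by omega) θ C
    (MonotonicCoding.descriptionLength_nonneg K m k) hE (mul_nonneg hε1.le hc0.le) hH hT hcost
    (hlen.trans (by gcongr))).trans (le_of_eq ?_)
  have hTtop : ENNReal.ofReal (1 + 1 / ρ) * (n : ℝ≥0∞) * T ≠ ∞ :=
    ENNReal.mul_ne_top (ENNReal.mul_ne_top ENNReal.ofReal_ne_top (ENNReal.natCast_ne_top n)) hT
  rw [MonotonicCoding.threeTermBound, ← hTdef, ← EReal.coe_ennreal_toReal hTtop, ← EReal.coe_add,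
    ← EReal.coe_mul, ENNReal.toReal_mul, ENNReal.toReal_mul, ENNReal.toReal_ofReal hc0.le,
    ENNReal.toReal_natCast, MonotonicCoding.modelCost]
  congr 1
  ring
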